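/- Let $N, D \ge 1$ and $L \ge 0$ be integers with $m := \min(N/2,\, D-1) \ge 2$ (in particular $D>1$). Inputs are sets of $2N$ vectors of $\mathbb{C}^D$, written as matrices $X \in \mathbb{C}^{D\times 2N}$ with columns $x_1,\dots,x_{2N}$. Let $\mathrm{Sym}_L$ be the class of functions $$f(X)=\rho\Big(\sum_{n=1}^{2N}\psi_1(x_n),\dots,\sum_{n=1}^{2N}\psi_L(x_n)\Big),$$ where $\psi_1,\dots,\psi_L:\mathbb{C}^D\to\mathbb{C}$ and $\rho:\mathbb{C}^L\to\mathbb{C}$ are arbitrary feed-forward neural networks (any depth, widths and complex weights) with analytic activations $\mathbb{C}\to\mathbb{C}$. Let $y\in(S^1)^N$ be random with density $\frac1{N!}\prod_{1\le i<j\le N}|y_j-y_i|^2$ with respect to the uniform probability measure on $(S^1)^N$, let $q,r$ be uniform on $(S^1)^D$, with $y,q,r$ independent, and let $X=X(y,q,r)$ have the entries $x_{dn}=q_d\,y_n$ for $1\le n\le N$ and $x_{dn}=r_d\,y_{n-N}$ for $N+1\le n\le 2N$. Put $\langle f,g\rangle_{\mathcal A}=\mathbb{E}\big[f(X)\overline{g(X)}\big]$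 and $\|f\|_{\mathcal A}^2=\langle f,f\rangle_{\mathcal A}$. Then $$\sup_{\|g\|_{\mathcal A}=1}\ \inf_{f\in \mathrm{Sym}_L}\ \|f-g\|_{\mathcal A}^2\ \ge\ \frac16-\frac{L}{6\cdot 2^{m}},$$ where $g$ ranges over the square-integrable functions that are invariant under permutations of the columns of $X$. The bound is witnessed by an explicit $g$. For $\alpha\in\mathbb{N}^D\setminus\{0\}$ let $|\alpha|=\sum_d\alpha_d$ and $\mathbf{p}_\alpha(X)=|\alpha|^{-1/2}\sum_{n=1}^{2N}\prod_{d=1}^D x_{dn}^{\alpha_d}$, let $T=\#\{\alpha\in\mathbb{N}^D:|\alpha|=\lfloor N/2\rfloor\}$, and put $$g=\frac{1}{\sqrt{12T}}\sum_{|\alpha|=\lfloor N/2\rfloor}\mathbf{p}_\alpha^2 .$$ Then $g$ is symmetric, $\|g\|_{\mathcal A}=1$, and $\|f-g\|_{\mathcal A}^2\ge \frac16-\frac{L}{6\cdot2^m}$ for every $f\in\mathrm{Sym}_L$. Consequently, if $L\le 2^{m-3}$, then $\sup_{\|g\|_{\mathcal A}=1}\inf_{f\in\mathrm{Sym}_L}\|f-g\|_{\mathcal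 A}^2\ge \frac{7}{48}$. So $\mathrm{Sym}_L$ (DeepSets) needs a symmetric width exponential in $\min(N,D)$ to get below this constant error. -/

import Mathlib

open MeasureTheory

noncomputable section

namespace DeepSets

/-! ### Networks and the class `Sym_L` -/

/-- `IsNetwork m n F`: the map `F : ℂ^m → ℂ^n` is computed by a feed-forward neural network of
arbitrary depth and widths, with complex weights and biases, and with analytic activations
`ℂ → ℂ`, which may vary from neuron to neuron (so a single activation per network, skip
connections, and an activation on the output are all allowed). -/
inductive IsNetwork (m : ℕ) : (n : ℕ) → ((Fin m → ℂ) → (Fin n → ℂ)) → Prop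
  | affine {n : ℕ} (W : Matrix (Fin n) (Fin m) ℂ) (b : Fin n → ℂ) :
      IsNetwork m n (fun x => W.mulVec x + b)
  | layer {k n : ℕ} (F : (Fin m → ℂ) → (Fin k → ℂ)) (hF : IsNetwork m k F)
      (σ : Fin k → ℂ → ℂ) (hσ : ∀ i, AnalyticOnNhd ℂ (σ i) Set.univ)
      (W : Matrix (Fin n) (Fin k) ℂ) (b : Fin n → ℂ) :
      IsNetwork m n (fun x => W.mulVec (fun i => σ i (F x i)) + b)

/-- A scalar-valued neural network with analytic activations. -/
def IsScalarNetwork (m : ℕ) (ψ : (Fin m → ℂ) → ℂ) : Prop :=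
  ∃ F : (Fin m → ℂ) → (Fin 1 → ℂ), IsNetwork m 1 F ∧ ∀ x, ψ x = F x 0

/-- `Sym_L`: the singleton symmetric networks (DeepSets) of symmetric width `L`, acting on sets of
`M` elements of `ℂ^D`, which are the columns of a `D × M` matrix. -/
def Sym (D M L : ℕ) : Set (Matrix (Fin D) (Fin M) ℂ → ℂ) :=
  {f | ∃ (ψ : Fin L → (Fin D → ℂ) → ℂ) (ρ : (Fin L → ℂ) → ℂ),
    (∀ l, IsScalarNetwork D (ψ l)) ∧ IsScalarNetwork L ρ ∧
      ∀ X, f X = ρ (fun l => ∑ n, ψ l (fun d => X d n))}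

/-- Invariance under permutations of the columns. -/
def IsSymmetric {D M : ℕ} (f : Matrix (Fin D) (Fin M) ℂ → ℂ) : Prop :=
  ∀ (π : Equiv.Perm (Fin M)) (X : Matrix (Fin D) (Fin M) ℂ), f (X.submatrix id π) = f X

/-! ### The inner product `⟨·,·⟩_𝒜` -/

/-- The uniform probability measure on the unit circle, as a measure on `ℂ`. -/
def circleLaw : Measure ℂ :=
  ((ENNReal.ofReal (2 * Real.pi))⁻¹ • volume.restrict (Set.Icc (0 : ℝ) (2 * Real.pi))).map
    (fun θ : ℝ => Complex.exp (θ * Complex.I))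

/-- The law of `n` i.i.d. uniform points of the unit circle. -/
def torusLaw (n : ℕ) : Measure (Fin n → ℂ) :=
  Measure.pi (fun _ => circleLaw)

/-- The Vandermonde product `∏_{i < j} (z_j - z_i)`. -/
def vandermondeProd {N : ℕ} (z : Fin N → ℂ) : ℂ :=
  ∏ i, ∏ j ∈ Finset.Ioi i, (z j - z i)

/-- The law `V` on the torus, with density `|V(y)|² / N!` with respect to the uniform law. -/
def vandermondeLaw (N : ℕ) : Measure (Fin N → ℂ) :=
  (torusLaw N).withDensity
    (fun y => ENNReal.ofReal (‖vandermondeProd y‖ ^ 2 / (Nat.factorial N : ℝ)))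

/-- The joint law of independent `y ∼ V` and `q, r` uniform on `(S¹)^D`. -/
def latentLaw (N D : ℕ) : Measure ((Fin N → ℂ) × (Fin D → ℂ) × (Fin D → ℂ)) :=
  (vandermondeLaw N).prod ((torusLaw D).prod (torusLaw D))

/-- The set input `X(y,q,r)`, with `2N` columns: `y_n q` for the first `N`,
and `y_n r` for the last `N`. -/
def setInput {N D : ℕ} (p : (Fin N → ℂ) × (Fin D → ℂ) × (Fin D → ℂ)) :
    Matrix (Fin D) (Fin (2 * N)) ℂ :=
  fun d n =>
    if h : (n : ℕ) < N then p.2.1 d * p.1 ⟨n, h⟩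
    else p.2.2 d * p.1 ⟨n - N, by have := n.isLt; omega⟩

/-- `⟨f, g⟩_𝒜 = 𝔼[f(X) conj(g(X))]`. -/
def innerA {N D : ℕ} (f g : Matrix (Fin D) (Fin (2 * N)) ℂ → ℂ) : ℂ :=
  ∫ p, f (setInput p) * (starRingEnd ℂ) (g (setInput p)) ∂(latentLaw N D)

/-- `‖f‖_𝒜 = √⟨f, f⟩_𝒜`. -/
def normA {N D : ℕ} (f : Matrix (Fin D) (Fin (2 * N)) ℂ → ℂ) : ℝ :=
  Real.sqrt (innerA f f).re

/-- The symmetric, square-integrable functions `g` with `‖g‖_𝒜 = 1`. -/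
def unitSphereA (N D : ℕ) : Set (Matrix (Fin D) (Fin (2 * N)) ℂ → ℂ) :=
  {g | IsSymmetric g ∧
    MemLp (fun p : (Fin N → ℂ) × (Fin D → ℂ) × (Fin D → ℂ) => g (setInput p)) 2
      (latentLaw N D) ∧
    normA g = 1}

/-! ### Multisymmetric power sums and the hard function -/

/-- The normalized multisymmetric power sum `p_α`, with `p_0 = 1`. -/
def multiPowerSum {D M : ℕ} (α : Fin D → ℕ) (X : Matrix (Fin D) (Fin M) ℂ) : ℂ :=
  if α = 0 then 1
  else ((1 / Real.sqrt ((∑ d, α d : ℕ) : ℝ) : ℝ) : ℂ) * ∑ n, ∏ d, X d n ^ α d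

/-- `g = (12 T)^{-1/2} ∑_{|α| = ⌊N/2⌋} p_α²`, with `T` the number of `α ∈ ℕ^D` in the sum. -/
def hardFunction (N D : ℕ) (X : Matrix (Fin D) (Fin (2 * N)) ℂ) : ℂ :=
  ((1 / Real.sqrt (12 * ((Finset.piAntidiag (Finset.univ : Finset (Fin D)) (N / 2)).card : ℝ)) : ℝ)
      : ℂ) *
    ∑ α ∈ Finset.piAntidiag (Finset.univ : Finset (Fin D)) (N / 2), multiPowerSum α X ^ 2

/-- The worst-case error of `Sym_L`:
the supremum over `‖g‖_𝒜 = 1` of the infimum over `f ∈ Sym_L` of `‖f - g‖_𝒜²`. -/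
def worstCaseError (N D L : ℕ) : ℝ :=
  ⨆ g : unitSphereA N D, ⨅ f : Sym D (2 * N) L, normA (f.1 - g.1) ^ 2

end DeepSets

end

noncomputable section

namespace DeepSets

/-! ### Alternating functions of integer exponent vectors -/

section Alternating

variable {N : ℕ}

/-! Put K = ⌊N/2⌋. On `setInput (y, q, r)` the power sum of a nonzero exponent γ factors as
p_{|γ|}(y) (q^γ + r^γ), up to its normalization. A polynomial network is ρ applied to L affine forms
in these power sums, so by the chain rule its Hessian at the origin, in the power sums as variables,
has rank at most L. The hard function is a multiple of ∑ X_α², and its Hessian on the T exponents of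
degree K is a multiple of the identity, which no matrix of rank L approximates well in Frobenius
norm.

The Hessian entries are visible in L²: pairing a polynomial P in the power sums with p_K(y)² q^α
r^β, where |α| = |β| = K, gives 2K² ∂_α∂_β P(0) (`integral_eval_mul_conj_testFunction`). The
variables q and r separate the two indices. The y part is the orthogonality of power sums under the
Vandermonde law: against p_K², multiplication by p_k is adjoint to k ∂/∂p_k as long as 2K ≤ N. This
is proved with alternants: multiplying an alternant by a power sum raises one exponent at a time,
alternants with a repeated exponent vanish, and alternants with a negative exponent are orthogonal
to polynomials. Everything then reduces to moving the entries of the staircase (0, …, N-1)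
(`shiftSum_shiftSum_shiftSum_stair`).

The normalized test functions are orthonormal, so Bessel's inequality and the rank bound
`le_sum_norm_sq_sub_ite` give an error of at least (2/3)(1 - L/T) for polynomial networks. Analytic
networks are uniform limits of polynomial ones on compact sets, so the bound passes to `Sym`.
Finally T = C(D+K-1, K) ≥ 2^m, and 2/3 is weakened to 1/6. -/

/-- `Φ` changes sign when two entries of its argument are swapped. -/
def IsAlternating (Φ : (Fin N → ℤ) → ℂ) : Prop :=
  ∀ m i j, i ≠ j → Φ (m ∘ Equiv.swap i j) = -Φ m

/-- The sum of the values of `Φ` when one entry is raised by `n`. -/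
def shiftSum (n : ℤ) (Φ : (Fin N → ℤ) → ℂ) (m : Fin N → ℤ) : ℂ :=
  ∑ a, Φ (m + Pi.single a n)

/-- The exponent vector `(0, 1, …, N - 1)`. -/
def stair (N : ℕ) : Fin N → ℤ := fun j => (j : ℕ)

theorem IsAlternating.eq_zero {Φ : (Fin N → ℤ) → ℂ} (h : IsAlternating Φ) {m : Fin N → ℤ}
    {i j : Fin N} (hij : i ≠ j) (hm : m i = m j) : Φ m = 0 := by
  have h1 := h m i j hij
  have h2 : m ∘ Equiv.swap i j = m := by
    funext x
    simp only [Function.comp, Equiv.swap_apply_def]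
    split_ifs with h3 h4
    · rw [h3, hm]
    · rw [h4, hm]
    · rfl
  rw [h2] at h1
  linear_combination h1 / 2

theorem IsAlternating.shiftSum {Φ : (Fin N → ℤ) → ℂ} (h : IsAlternating Φ) (n : ℤ) :
    IsAlternating (shiftSum n Φ) := by
  intro m i j hij
  unfold DeepSets.shiftSum
  rw [← Finset.sum_neg_distrib, ← Equiv.sum_comp (Equiv.swap i j)]
  refine Finset.sum_congr rfl fun a _ => ?_
  rw [← h _ i j hij]
  congr 1
  funext x
  simp only [Function.comp, Pi.add_apply, Pi.single_apply]
  by_cases hx : x = Equiv.swap i j a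
  · simp [hx]
  · rw [if_neg hx, if_neg]
    intro h'
    exact hx (by rw [← h']; simp)

theorem shiftSum_comm (a b : ℤ) (Φ : (Fin N → ℤ) → ℂ) :
    shiftSum a (shiftSum b Φ) = shiftSum b (shiftSum a Φ) := by
  funext m
  unfold shiftSum
  rw [Finset.sum_comm]
  simp_rw [add_right_comm]

/-- An alternating function vanishes at the staircase with entry `j` moved to the place of another
entry. -/
theorem IsAlternating.stair_single_eq_zero {Φ : (Fin N → ℤ) → ℂ} (h : IsAlternating Φ)
    (j : Fin N) (n : ℤ) (hn : n ≠ 0) (h0 : 0 ≤ (j : ℤ) + n) (h1 : (j : ℤ) + n < N) :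
    Φ (stair N + Pi.single j n) = 0 := by
  obtain ⟨x, hx⟩ := Int.eq_ofNat_of_zero_le h0
  have hxN : x < N := by omega
  have hne : (⟨x, hxN⟩ : Fin N) ≠ j := by
    intro h'
    have := congrArg Fin.val h'
    simp at this
    omega
  refine h.eq_zero hne ?_
  simp [stair, hne, hx]

variable {Φ : (Fin N → ℤ) → ℂ}

/-- Lowering entry j of the staircase by k either makes it negative or makes it collide with entry j
- k. -/
theorem shiftSum_neg_stair (hΦ : IsAlternating Φ) (hneg : ∀ m j, m j < 0 → Φ m = 0)
    {k : ℕ} (hk : 1 ≤ k) : shiftSum (-k) Φ (stair N) = 0 := by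
  refine Finset.sum_eq_zero fun j _ => ?_
  by_cases hj : (j : ℕ) < k
  · exact hneg _ j (by simp [stair]; omega)
  · exact hΦ.stair_single_eq_zero j _ (by omega) (by omega) (by omega)

/-- A negative entry survives unless it is the one that is raised, so only one summand remains. -/
theorem shiftSum_eq_of_neg (hneg : ∀ m j, m j < 0 → Φ m = 0) {m : Fin N → ℤ} {j : Fin N}
    (hj : m j < 0) (n : ℤ) : shiftSum n Φ m = Φ (m + Pi.single j n) := by
  unfold shiftSum
  refine Finset.sum_eq_single j (fun b _ hb => hneg _ j ?_) (by simp)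
  simp [hb.symm, hj]

theorem card_filter_fin_lt {K : ℕ} (hK : K ≤ N) :
    (Finset.univ.filter fun j : Fin N => (j : ℕ) < K).card = K := by
  rw [Fin.card_filter_val_lt]; omega

/-- Lowering entry j by K produces a collision if j ≥ K. If j < K the entry is negative and must be
raised back, which restores the staircase; there are K such j. In terms of power sums, this is the
orthogonality relation E|p_K|² = K. -/
theorem shiftSum_shiftSum_stair (hΦ : IsAlternating Φ) (hneg : ∀ m j, m j < 0 → Φ m = 0)
    {K : ℕ} (hK : 1 ≤ K) (hN : K ≤ N) :
    shiftSum (-K) (shiftSum K Φ) (stair N) = K * Φ (stair N) := by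
  have h : ∀ j : Fin N, shiftSum K Φ (stair N + Pi.single j (-K : ℤ)) =
      if (j : ℕ) < K then Φ (stair N) else 0 := by
    intro j
    split_ifs with hj
    · rw [shiftSum_eq_of_neg hneg (j := j) (by simp [stair]; omega), add_assoc, ← Pi.single_add]
      simp
    · exact (hΦ.shiftSum K).stair_single_eq_zero j _ (by omega) (by omega) (by omega)
  rw [shiftSum, Finset.sum_congr rfl fun j _ => h j, ← Finset.sum_filter, Finset.sum_const,
    card_filter_fin_lt hN, nsmul_eq_mul]

/-- This is k ∂/∂p_k applied to p_K². An entry j < k lowered by k is negative, so at least one of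
the two raises by K must hit it; inclusion–exclusion over which one does gives the formula `h`.
Since 2K ≤ N, entries moved within the staircase range collide and contribute nothing. -/
theorem shiftSum_shiftSum_shiftSum_stair (hΦ : IsAlternating Φ)
    (hneg : ∀ m j, m j < 0 → Φ m = 0) {K k : ℕ} (hK : 1 ≤ K) (hN : 2 * K ≤ N) (hk : 1 ≤ k) :
    shiftSum (-k) (shiftSum K (shiftSum K Φ)) (stair N) =
      if k = K then 2 * K * shiftSum K Φ (stair N) else 0 := by
  have h : ∀ j : Fin N, shiftSum K (shiftSum K Φ) (stair N + Pi.single j (-k : ℤ)) =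
      if (j : ℕ) < k then 2 * shiftSum K Φ (stair N + Pi.single j ((K : ℤ) - k)) -
        Φ (stair N + Pi.single j (2 * K - k : ℤ)) else 0 := by
    intro j
    split_ifs with hj
    · have h1 : ∀ a, a ≠ j → shiftSum K Φ (stair N + Pi.single j (-k : ℤ) + Pi.single a (K : ℤ))
          = Φ (stair N + Pi.single j ((K : ℤ) - k) + Pi.single a (K : ℤ)) := by
        intro a ha
        rw [shiftSum_eq_of_neg hneg (j := j) (by simp [stair, ha.symm]; omega)]
        rw [sub_eq_add_neg, Pi.single_add]
        congr 1
        abel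
      rw [shiftSum, ← Finset.add_sum_erase _ _ (Finset.mem_univ j),
        Finset.sum_congr rfl fun a ha => h1 a (Finset.ne_of_mem_erase ha)]
      have h2 : shiftSum K Φ (stair N + Pi.single j ((K : ℤ) - k)) = _ :=
        (Finset.add_sum_erase _ _ (Finset.mem_univ j)).symm
      rw [add_assoc, ← Pi.single_add, neg_add_eq_sub]
      have h3 : Φ (stair N + Pi.single j ((K : ℤ) - k) + Pi.single j (K : ℤ)) =
          Φ (stair N + Pi.single j (2 * K - k : ℤ)) := by
        rw [add_assoc, ← Pi.single_add]
        congr 3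
        ring
      rw [h3] at h2
      linear_combination -h2
    · exact ((hΦ.shiftSum K).shiftSum K).stair_single_eq_zero j _ (by omega) (by omega) (by omega)
  rw [shiftSum, Finset.sum_congr rfl fun j _ => h j]
  rcases lt_trichotomy k K with hkK | hkK | hkK
  · rw [if_neg hkK.ne]
    refine Finset.sum_eq_zero fun j _ => ?_
    split_ifs with hj
    · rw [(hΦ.shiftSum K).stair_single_eq_zero j _ (by omega) (by omega) (by omega),
        hΦ.stair_single_eq_zero j _ (by omega) (by omega) (by omega)]
      simp
    · rfl
  · subst hkK
    rw [if_pos rfl, ← Finset.sum_filter]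
    have h1 : ∀ j ∈ Finset.univ.filter (fun j : Fin N => (j : ℕ) < k),
        2 * shiftSum k Φ (stair N + Pi.single j ((k : ℤ) - k)) -
        Φ (stair N + Pi.single j (2 * k - k : ℤ)) = 2 * shiftSum k Φ (stair N) := by
      intro j hj
      have hj' : (j : ℕ) < k := by simpa using hj
      rw [hΦ.stair_single_eq_zero j _ (by omega) (by omega) (by omega)]
      simp
    rw [Finset.sum_congr rfl h1, Finset.sum_const, card_filter_fin_lt (by omega), nsmul_eq_mul]
    ring
  · rw [if_neg hkK.ne']
    have hs : ∀ j : Fin N, (j : ℕ) < k → shiftSum K Φ (stair N + Pi.single j ((K : ℤ) - k)) =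
        if (j : ℤ) + K - k < 0 then Φ (stair N + Pi.single j (2 * K - k : ℤ)) else 0 := by
      intro j hj
      split_ifs with h0
      · rw [shiftSum_eq_of_neg hneg (j := j) (by simp [stair]; omega), add_assoc, ← Pi.single_add]
        congr 3
        ring
      · exact (hΦ.shiftSum K).stair_single_eq_zero j _ (by omega) (by omega) (by omega)
    -- The exceptional case: raising j twice restores the staircase. The K entries j < K count twice
    -- and the 2K entries j < 2K are subtracted once, so the terms cancel.
    by_cases h2 : k = 2 * K
    · subst h2
      have h1 : ∀ j : Fin N, (if (j : ℕ) < 2 * K then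
          2 * shiftSum K Φ (stair N + Pi.single j ((K : ℤ) - (2 * K : ℕ))) -
            Φ (stair N + Pi.single j (2 * K - (2 * K : ℕ) : ℤ)) else 0) =
          2 * (if (j : ℕ) < K then Φ (stair N) else 0) -
            if (j : ℕ) < 2 * K then Φ (stair N) else 0 := by
        intro j
        by_cases hj : (j : ℕ) < 2 * K
        · rw [if_pos hj, hs j hj]
          have h3 : ((j : ℤ) + K - (2 * K : ℕ) < 0) ↔ (j : ℕ) < K := by omega
          rw [if_congr h3 rfl rfl]
          simp [hj]
        · have : ¬ (j : ℕ) < K := by omega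
          simp [hj, this]
      rw [Finset.sum_congr rfl fun j _ => h1 j, Finset.sum_sub_distrib, ← Finset.mul_sum,
        ← Finset.sum_filter, ← Finset.sum_filter, Finset.sum_const, Finset.sum_const,
        card_filter_fin_lt (by omega), card_filter_fin_lt hN]
      simp only [nsmul_eq_mul]
      push_cast
      ring
    · refine Finset.sum_eq_zero fun j _ => ?_
      split_ifs with hj
      · rw [hs j hj]
        have h3 : Φ (stair N + Pi.single j (2 * K - k : ℤ)) = 0 := by
          by_cases h4 : (j : ℤ) + 2 * K - k < 0
          · exact hneg _ j (by simp [stair]; omega)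
          · exact hΦ.stair_single_eq_zero j _ (by omega) (by omega) (by omega)
        simp [h3]
      · rfl

end Alternating

/-! ### Integration over the torus -/

theorem continuous_exp_mul_I : Continuous fun θ : ℝ => Complex.exp (θ * Complex.I) := by
  fun_prop

instance : IsProbabilityMeasure circleLaw := by
  unfold circleLaw
  have hpi : ENNReal.ofReal (2 * Real.pi) ≠ 0 := by
    simp [Real.pi_pos]
  have : IsProbabilityMeasure
      ((ENNReal.ofReal (2 * Real.pi))⁻¹ • volume.restrict (Set.Icc (0 : ℝ) (2 * Real.pi))) := by
    constructor
    simp only [Measure.smul_apply, Measure.restrict_apply MeasurableSet.univ, Set.univ_inter,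
      Real.volume_Icc, sub_zero, smul_eq_mul]
    exact ENNReal.inv_mul_cancel hpi ENNReal.ofReal_ne_top
  exact Measure.isProbabilityMeasure_map continuous_exp_mul_I.aemeasurable

instance (n : ℕ) : IsProbabilityMeasure (torusLaw n) := by
  unfold torusLaw; infer_instance

theorem ae_circleLaw : ∀ᵐ z ∂circleLaw, ‖z‖ = 1 := by
  unfold circleLaw
  rw [ae_map_iff continuous_exp_mul_I.aemeasurable
    (measurableSet_eq_fun measurable_norm measurable_const)]
  exact Filter.Eventually.of_forall fun θ => Complex.norm_exp_ofReal_mul_I θ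

/-- The torus `(S¹)^n`. -/
def torus (n : ℕ) : Set (Fin n → ℂ) := {y | ∀ i, ‖y i‖ = 1}

theorem ae_torusLaw (n : ℕ) : ∀ᵐ y ∂torusLaw n, y ∈ torus n := by
  unfold torusLaw torus
  simp only [Set.mem_ofPred_eq]
  rw [ae_all_iff]
  intro i
  exact (Measure.tendsto_eval_ae_ae (μ := fun _ : Fin n => circleLaw) (i := i)).eventually
    ae_circleLaw

theorem isCompact_torus (n : ℕ) : IsCompact (torus n) := by
  have : torus n = Set.pi Set.univ fun _ => Metric.sphere (0 : ℂ) 1 := by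
    ext; simp [torus]
  rw [this]
  exact isCompact_univ_pi fun _ => isCompact_sphere _ _

theorem integrable_of_continuousOn_of_ae_mem {X : Type*} [TopologicalSpace X] [T2Space X]
    [MeasurableSpace X] [OpensMeasurableSpace X] {μ : Measure X} [IsFiniteMeasure μ] {s : Set X}
    (hs : IsCompact s) (hμ : ∀ᵐ x ∂μ, x ∈ s) {f : X → ℂ} (hf : ContinuousOn f s) :
    Integrable f μ := by
  have := hf.integrableOn_compact (μ := μ) hs
  rwa [IntegrableOn, Measure.restrict_eq_self_of_ae_mem hμ] at this

theorem integrable_torusLaw {n : ℕ} {f : (Fin n → ℂ) → ℂ} (hf : ContinuousOn f (torus n)) :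
    Integrable f (torusLaw n) :=
  integrable_of_continuousOn_of_ae_mem (isCompact_torus n) (ae_torusLaw n) hf

/-- The second exponent is an integer because alternants are allowed negative exponents, while
polynomials are not. -/
theorem integral_circleLaw_pow_mul_conj_zpow (a : ℕ) (b : ℤ) :
    ∫ z, z ^ a * (starRingEnd ℂ) (z ^ b) ∂circleLaw = if (a : ℤ) = b then 1 else 0 := by
  unfold circleLaw
  rw [integral_map continuous_exp_mul_I.aemeasurable (by fun_prop), integral_smul_measure]
  have h1 : ∀ θ : ℝ, Complex.exp (θ * Complex.I) ^ a *
      (starRingEnd ℂ) (Complex.exp (θ * Complex.I) ^ b) =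
      Complex.exp ((((a : ℤ) - b : ℤ) * Complex.I) * θ) := by
    intro θ
    rw [← Complex.exp_nat_mul, ← Complex.exp_int_mul, ← Complex.exp_conj, ← Complex.exp_add]
    congr 1
    simp
    ring
  simp_rw [h1]
  rw [integral_Icc_eq_integral_Ioc, ← intervalIntegral.integral_of_le (by positivity)]
  split_ifs with h
  · have hp : (0 : ℝ) ≤ 2 * Real.pi := by positivity
    simp only [h, sub_self, Int.cast_zero, zero_mul, Complex.exp_zero,
      intervalIntegral.integral_const, sub_zero, ENNReal.toReal_inv, ENNReal.toReal_ofReal hp]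
    rw [smul_smul, inv_mul_cancel₀ (by positivity), one_smul]
  · have hc : (((a : ℤ) - b : ℤ) * Complex.I) ≠ 0 := by
      refine mul_ne_zero ?_ Complex.I_ne_zero
      exact_mod_cast sub_ne_zero.mpr h
    rw [integral_exp_mul_complex hc]
    have : Complex.exp ((((a : ℤ) - b : ℤ) * Complex.I) * (2 * Real.pi : ℝ)) = 1 := by
      rw [← Complex.exp_int_mul_two_pi_mul_I ((a : ℤ) - b)]
      congr 1
      push_cast
      ring
    rw [this]
    simp

theorem integral_torusLaw_monomial {n : ℕ} (a : Fin n → ℕ) (b : Fin n → ℤ) :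
    ∫ y, (∏ i, y i ^ a i) * (starRingEnd ℂ) (∏ i, y i ^ b i) ∂torusLaw n =
      if (fun i => (a i : ℤ)) = b then 1 else 0 := by
  have h : ∀ y : Fin n → ℂ, (∏ i, y i ^ a i) * (starRingEnd ℂ) (∏ i, y i ^ b i) =
      ∏ i, (y i ^ a i * (starRingEnd ℂ) (y i ^ b i)) := by
    intro y
    rw [map_prod, Finset.prod_mul_distrib]
  simp_rw [h]
  unfold torusLaw
  rw [integral_fintype_prod_eq_prod (fun i z => z ^ a i * (starRingEnd ℂ) (z ^ b i))]
  simp_rw [integral_circleLaw_pow_mul_conj_zpow]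
  rw [Finset.prod_ite_zero]
  simp [funext_iff]

/-! ### Alternants -/

/-- The alternant `det (y_j ^ m_i)`. -/
def alternant {N : ℕ} (m : Fin N → ℤ) (y : Fin N → ℂ) : ℂ :=
  (Matrix.of fun i j => y j ^ m i).det

theorem alternant_eq_sum {N : ℕ} (m : Fin N → ℤ) (y : Fin N → ℂ) :
    alternant m y = ∑ σ : Equiv.Perm (Fin N),
      ((Equiv.Perm.sign σ : ℤ) : ℂ) * ∏ i, y i ^ m (σ i) := by
  simp [alternant, Matrix.det_apply']

theorem alternant_stair {N : ℕ} (y : Fin N → ℂ) : alternant (stair N) y = vandermondeProd y := by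
  rw [vandermondeProd, ← Matrix.det_vandermonde, ← Matrix.det_transpose, alternant]
  congr 1

theorem isAlternating_alternant {N : ℕ} (y : Fin N → ℂ) (m : Fin N → ℤ) {i j : Fin N}
    (hij : i ≠ j) : alternant (m ∘ Equiv.swap i j) y = -alternant m y := by
  have := Matrix.det_permute (Equiv.swap i j) (Matrix.of fun i j => y j ^ m i)
  rw [Equiv.Perm.sign_swap hij] at this
  simp only [Units.val_neg, Units.val_one, Int.cast_neg, Int.cast_one, neg_one_mul] at this
  exact this

/-- In the Leibniz expansion, multiplying the term of σ by y_j^n raises the exponent with index σ j;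
summing over j and reindexing by σ gives every shift once. -/
theorem sum_zpow_mul_alternant {N : ℕ} (m : Fin N → ℤ) (n : ℤ) {y : Fin N → ℂ}
    (hy : ∀ i, y i ≠ 0) :
    (∑ i, y i ^ n) * alternant m y = ∑ j, alternant (m + Pi.single j n) y := by
  simp_rw [alternant_eq_sum]
  rw [Finset.sum_comm, Finset.mul_sum]
  refine Finset.sum_congr rfl fun σ _ => ?_
  have h : ∀ j, ∏ i, y i ^ ((m + Pi.single (σ j) n : Fin N → ℤ) (σ i)) =
      y j ^ n * ∏ i, y i ^ m (σ i) := by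
    intro j
    have : ∀ i, y i ^ ((m + Pi.single (σ j) n : Fin N → ℤ) (σ i)) =
        (if i = j then y i ^ n else 1) * y i ^ m (σ i) := by
      intro i
      rw [Pi.add_apply, zpow_add₀ (hy i), mul_comm, Pi.single_apply]
      simp only [EmbeddingLike.apply_eq_iff_eq]
      split_ifs <;> simp
    simp_rw [this]
    rw [Finset.prod_mul_distrib]
    simp
  have hs : ∑ j, ∏ i, y i ^ ((m + Pi.single j n : Fin N → ℤ) (σ i)) =
      (∑ j, y j ^ n) * ∏ i, y i ^ m (σ i) := by
    rw [← Equiv.sum_comp σ, Finset.sum_congr rfl fun j _ => h j, ← Finset.sum_mul]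
  rw [← Finset.mul_sum, hs]
  ring

theorem ne_zero_of_mem_torus {n : ℕ} {y : Fin n → ℂ} (hy : y ∈ torus n) (i : Fin n) :
    y i ≠ 0 := by
  intro h
  have := hy i
  rw [h] at this
  simp at this

theorem continuousOn_alternant {N : ℕ} (m : Fin N → ℤ) :
    ContinuousOn (alternant m) (torus N) := by
  have : alternant m = fun y => ∑ σ : Equiv.Perm (Fin N),
      ((Equiv.Perm.sign σ : ℤ) : ℂ) * ∏ i, y i ^ m (σ i) := funext (alternant_eq_sum m)
  rw [this]
  refine continuousOn_finsetSum _ fun σ _ => continuousOn_const.mul ?_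
  refine continuousOn_finsetProd _ fun i _ => ?_
  exact (continuous_apply i).continuousOn.zpow₀ _ fun y hy => Or.inl (ne_zero_of_mem_torus hy i)

theorem conj_eq_zpow_of_mem_torus {n : ℕ} {y : Fin n → ℂ} (hy : y ∈ torus n) (i : Fin n)
    (k : ℕ) : (starRingEnd ℂ) (y i ^ (-k : ℤ)) = y i ^ k := by
  rw [zpow_neg, zpow_natCast, ← inv_pow, map_pow, map_inv₀]
  congr 1
  rw [inv_eq_iff_eq_inv, Complex.inv_def, Complex.normSq_eq_norm_sq, hy i]
  simp

/-- The pairing of a polynomial with an alternant. -/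
def alternantPairing {N : ℕ} (P : MvPolynomial (Fin N) ℂ) (m : Fin N → ℤ) : ℂ :=
  ∫ y, MvPolynomial.eval y P * (starRingEnd ℂ) (alternant m y) ∂torusLaw N

theorem continuousOn_eval_mul_conj_alternant {N : ℕ} (P : MvPolynomial (Fin N) ℂ)
    (m : Fin N → ℤ) :
    ContinuousOn (fun y => MvPolynomial.eval y P * (starRingEnd ℂ) (alternant m y)) (torus N) :=
  (MvPolynomial.continuous_eval P).continuousOn.mul
    (Complex.continuous_conj.comp_continuousOn (continuousOn_alternant m))

theorem isAlternating_alternantPairing {N : ℕ} (P : MvPolynomial (Fin N) ℂ) :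
    IsAlternating (alternantPairing P) := by
  intro m i j hij
  unfold alternantPairing
  simp_rw [isAlternating_alternant _ m hij, map_neg, mul_neg]
  rw [integral_neg]

theorem alternantPairing_eq_sum {N : ℕ} (P : MvPolynomial (Fin N) ℂ) (m : Fin N → ℤ) :
    alternantPairing P m = ∑ d ∈ P.support, ∑ σ : Equiv.Perm (Fin N),
      P.coeff d * ((Equiv.Perm.sign σ : ℤ) : ℂ) *
        if (fun i => (d i : ℤ)) = m ∘ σ then 1 else 0 := by
  have h : ∀ y : Fin N → ℂ, MvPolynomial.eval y P * (starRingEnd ℂ) (alternant m y) =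
      ∑ d ∈ P.support, ∑ σ : Equiv.Perm (Fin N), P.coeff d * ((Equiv.Perm.sign σ : ℤ) : ℂ) *
        ((∏ i, y i ^ d i) * (starRingEnd ℂ) (∏ i, y i ^ (m ∘ σ) i)) := by
    intro y
    rw [MvPolynomial.eval_eq', alternant_eq_sum, map_sum, Finset.sum_mul]
    refine Finset.sum_congr rfl fun d _ => ?_
    rw [Finset.mul_sum]
    refine Finset.sum_congr rfl fun σ _ => ?_
    rw [map_mul, map_intCast]
    simp only [Function.comp]
    ring
  have hint : ∀ (d : Fin N →₀ ℕ) (σ : Equiv.Perm (Fin N)), Integrable (fun y : Fin N → ℂ =>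
      P.coeff d * ((Equiv.Perm.sign σ : ℤ) : ℂ) *
        ((∏ i, y i ^ d i) * (starRingEnd ℂ) (∏ i, y i ^ (m ∘ σ) i))) (torusLaw N) := by
    intro d σ
    refine integrable_torusLaw (continuousOn_const.mul (ContinuousOn.mul ?_ ?_))
    · exact Continuous.continuousOn (by fun_prop)
    · refine Complex.continuous_conj.comp_continuousOn (continuousOn_finsetProd _ fun i _ => ?_)
      exact (continuous_apply i).continuousOn.zpow₀ _
        fun y hy => Or.inl (ne_zero_of_mem_torus hy i)
  unfold alternantPairing
  simp_rw [h]
  rw [integral_finsetSum _ fun d _ => integrable_finsetSum _ fun σ _ => hint d σ]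
  refine Finset.sum_congr rfl fun d _ => ?_
  rw [integral_finsetSum _ fun σ _ => hint d σ]
  refine Finset.sum_congr rfl fun σ _ => ?_
  rw [integral_const_mul, integral_torusLaw_monomial]

/-- Every monomial of such an alternant has a negative exponent, so it is orthogonal to all
monomials of P. -/
theorem alternantPairing_eq_zero_of_neg {N : ℕ} (P : MvPolynomial (Fin N) ℂ) (m : Fin N → ℤ)
    (j : Fin N) (hj : m j < 0) : alternantPairing P m = 0 := by
  rw [alternantPairing_eq_sum]
  refine Finset.sum_eq_zero fun d _ => Finset.sum_eq_zero fun σ _ => ?_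
  rw [if_neg, mul_zero]
  intro h
  have := congrFun h (σ.symm j)
  simp at this
  omega

/-- On the torus p_k is the conjugate of p_{-k}, so it can be moved to the alternant, where it
lowers exponents. -/
theorem alternantPairing_psum_mul {N : ℕ} (k : ℕ) (P : MvPolynomial (Fin N) ℂ)
    (m : Fin N → ℤ) :
    alternantPairing (MvPolynomial.psum (Fin N) ℂ k * P) m =
      shiftSum (-k) (alternantPairing P) m := by
  unfold shiftSum alternantPairing
  rw [← integral_finsetSum _ fun j _ =>
    integrable_torusLaw (continuousOn_eval_mul_conj_alternant P _)]
  refine integral_congr_ae ?_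
  filter_upwards [ae_torusLaw N] with y hy
  rw [← Finset.mul_sum, ← map_sum, ← sum_zpow_mul_alternant m _ (ne_zero_of_mem_torus hy), map_mul,
    map_mul, map_sum]
  simp_rw [conj_eq_zpow_of_mem_torus hy]
  simp only [MvPolynomial.psum, map_sum, map_pow, MvPolynomial.eval_X]
  ring

/-- Each conjugated factor p_K is absorbed into the alternant as a raising shift. -/
theorem integral_eval_mul_conj_psum_mul_alternant {N : ℕ} (P : MvPolynomial (Fin N) ℂ) (K : ℕ)
    (j : ℕ) (m : Fin N → ℤ) :
    ∫ y, MvPolynomial.eval y P * (starRingEnd ℂ) ((∑ i, y i ^ K) ^ j * alternant m y)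
      ∂torusLaw N = (shiftSum K)^[j] (alternantPairing P) m := by
  induction j generalizing m with
  | zero => simp [alternantPairing]
  | succ j ih =>
    rw [Function.iterate_succ_apply', shiftSum]
    simp_rw [← ih]
    rw [← integral_finsetSum]
    · refine integral_congr_ae ?_
      filter_upwards [ae_torusLaw N] with y hy
      have := sum_zpow_mul_alternant m K (ne_zero_of_mem_torus hy)
      simp only [zpow_natCast] at this
      rw [← Finset.mul_sum, ← map_sum, ← Finset.mul_sum, ← this]
      ring_nf
    · intro a _
      refine integrable_torusLaw ?_
      refine (MvPolynomial.continuous_eval P).continuousOn.mul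
        (Complex.continuous_conj.comp_continuousOn (ContinuousOn.mul ?_ (continuousOn_alternant _)))
      exact Continuous.continuousOn (by fun_prop)

/-! ### Power sums under the Vandermonde law -/

theorem continuous_vandermondeProd {N : ℕ} :
    Continuous (vandermondeProd : (Fin N → ℂ) → ℂ) := by
  unfold vandermondeProd
  fun_prop

theorem integral_vandermondeLaw {N : ℕ} (f : (Fin N → ℂ) → ℂ) :
    ∫ y, f y ∂vandermondeLaw N = ((Nat.factorial N : ℝ) : ℂ)⁻¹ *
      ∫ y, f y * (vandermondeProd y * (starRingEnd ℂ) (vandermondeProd y)) ∂torusLaw N := by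
  unfold vandermondeLaw
  have hm : Measurable fun y : Fin N → ℂ =>
      ENNReal.ofReal (‖vandermondeProd y‖ ^ 2 / (Nat.factorial N : ℝ)) := by
    have := (continuous_vandermondeProd (N := N)).measurable
    fun_prop
  rw [integral_withDensity_eq_integral_toReal_smul hm
    (Filter.Eventually.of_forall fun _ => ENNReal.ofReal_lt_top), ← integral_const_mul]
  refine integral_congr_ae (Filter.Eventually.of_forall fun y => ?_)
  simp only
  rw [ENNReal.toReal_ofReal (by positivity), Complex.mul_conj, Complex.normSq_eq_norm_sq,
    Complex.real_smul]
  push_cast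
  ring

/-- The Vandermonde product as a polynomial. -/
def vandermondePoly (N : ℕ) : MvPolynomial (Fin N) ℂ :=
  ∏ i, ∏ j ∈ Finset.Ioi i, (MvPolynomial.X j - MvPolynomial.X i)

theorem eval_vandermondePoly {N : ℕ} (y : Fin N → ℂ) :
    MvPolynomial.eval y (vandermondePoly N) = vandermondeProd y := by
  simp [vandermondePoly, vandermondeProd]

theorem integral_vandermondeLaw_eval_mul_conj {N : ℕ} (P : MvPolynomial (Fin N) ℂ) (K j : ℕ) :
    ∫ y, MvPolynomial.eval y P * (starRingEnd ℂ) ((∑ i, y i ^ K) ^ j) ∂vandermondeLaw N =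
      ((Nat.factorial N : ℝ) : ℂ)⁻¹ *
        (shiftSum K)^[j] (alternantPairing (P * vandermondePoly N)) (stair N) := by
  rw [integral_vandermondeLaw, ← integral_eval_mul_conj_psum_mul_alternant]
  simp_rw [alternant_stair, map_mul, eval_vandermondePoly]
  congr 2
  funext y
  ring

/-- Expanding both determinants, only equal permutations pair nontrivially, and each contributes 1.
This makes the Vandermonde law a probability measure. -/
theorem alternantPairing_vandermondePoly (N : ℕ) :
    alternantPairing (vandermondePoly N) (stair N) = Nat.factorial N := by
  have h : ∀ y : Fin N → ℂ, MvPolynomial.eval y (vandermondePoly N) *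
      (starRingEnd ℂ) (alternant (stair N) y) =
      ∑ σ : Equiv.Perm (Fin N), ∑ τ : Equiv.Perm (Fin N),
        ((Equiv.Perm.sign σ : ℤ) : ℂ) * ((Equiv.Perm.sign τ : ℤ) : ℂ) *
        ((∏ i, y i ^ (σ i : ℕ)) * (starRingEnd ℂ) (∏ i, y i ^ stair N (τ i))) := by
    intro y
    rw [eval_vandermondePoly, ← alternant_stair, alternant_eq_sum, map_sum, Finset.sum_mul_sum]
    refine Finset.sum_congr rfl fun σ _ => Finset.sum_congr rfl fun τ _ => ?_
    rw [map_mul, map_intCast]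
    simp only [stair, zpow_natCast]
    ring
  unfold alternantPairing
  simp_rw [h]
  have hint : ∀ σ τ : Equiv.Perm (Fin N), Integrable (fun y : Fin N → ℂ =>
      ((Equiv.Perm.sign σ : ℤ) : ℂ) * ((Equiv.Perm.sign τ : ℤ) : ℂ) *
        ((∏ i, y i ^ (σ i : ℕ)) * (starRingEnd ℂ) (∏ i, y i ^ stair N (τ i)))) (torusLaw N) := by
    intro σ τ
    refine integrable_torusLaw (Continuous.continuousOn ?_)
    simp only [stair, zpow_natCast]
    have := Complex.continuous_conj
    fun_prop
  rw [integral_finsetSum _ fun σ _ => integrable_finsetSum _ fun τ _ => hint σ τ]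
  have : ∀ σ : Equiv.Perm (Fin N), ∫ y : Fin N → ℂ, ∑ τ : Equiv.Perm (Fin N),
      ((Equiv.Perm.sign σ : ℤ) : ℂ) * ((Equiv.Perm.sign τ : ℤ) : ℂ) *
        ((∏ i, y i ^ (σ i : ℕ)) * (starRingEnd ℂ) (∏ i, y i ^ stair N (τ i))) ∂torusLaw N = 1 := by
    intro σ
    rw [integral_finsetSum _ fun τ _ => hint σ τ]
    simp_rw [integral_const_mul, integral_torusLaw_monomial (fun i => (σ i : ℕ))]
    rw [Finset.sum_eq_single σ]
    · rw [if_pos (by rfl), mul_one, ← Int.cast_mul, ← Units.val_mul, Int.units_mul_self]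
      simp
    · intro τ _ hτ
      rw [if_neg, mul_zero]
      intro h'
      refine hτ (Equiv.ext fun i => ?_)
      have := congrFun h' i
      simp only [stair, Nat.cast_inj] at this
      exact (Fin.ext this).symm
    · simp
  simp_rw [this]
  simp [Fintype.card_perm]

/-- `𝔼[P(y) conj(p_K(y)^2)]` for `y` distributed by the Vandermonde law. -/
def powerMoment (N K : ℕ) (P : MvPolynomial (Fin N) ℂ) : ℂ :=
  ∫ y, MvPolynomial.eval y P * (starRingEnd ℂ) ((∑ i, y i ^ K) ^ 2) ∂vandermondeLaw N

/-- The adjointness of p_k and k ∂/∂p_k, tested on p_K². The shifts commute, so the lowering one can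
be brought outermost, where the staircase computation applies. -/
theorem powerMoment_psum_mul {N K k : ℕ} (hK : 1 ≤ K) (hN : 2 * K ≤ N) (hk : 1 ≤ k)
    (P : MvPolynomial (Fin N) ℂ) :
    powerMoment N K (MvPolynomial.psum (Fin N) ℂ k * P) = if k = K then
      2 * K * ∫ y, MvPolynomial.eval y P * (starRingEnd ℂ) ((∑ i, y i ^ K) ^ 1) ∂vandermondeLaw N
      else 0 := by
  have h := shiftSum_shiftSum_shiftSum_stair (N := N)
    (isAlternating_alternantPairing (P * vandermondePoly N))
    (alternantPairing_eq_zero_of_neg _) hK hN hk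
  rw [powerMoment, integral_vandermondeLaw_eval_mul_conj, integral_vandermondeLaw_eval_mul_conj,
    mul_assoc]
  have h2 : alternantPairing (MvPolynomial.psum (Fin N) ℂ k * (P * vandermondePoly N)) =
      shiftSum (-k) (alternantPairing (P * vandermondePoly N)) :=
    funext (alternantPairing_psum_mul k _)
  simp only [Function.iterate_succ, Function.iterate_zero, Function.comp, id]
  rw [h2, shiftSum_comm K (-k), shiftSum_comm K (-k), h]
  split_ifs <;> ring

theorem integral_psum_mul_conj_psum {N K : ℕ} (hK : 1 ≤ K) (hN : K ≤ N)
    (P : MvPolynomial (Fin N) ℂ) :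
    ∫ y, MvPolynomial.eval y (MvPolynomial.psum (Fin N) ℂ K * P) *
      (starRingEnd ℂ) ((∑ i, y i ^ K) ^ 1) ∂vandermondeLaw N =
      K * ∫ y, MvPolynomial.eval y P * (starRingEnd ℂ) ((∑ i, y i ^ K) ^ 0) ∂vandermondeLaw N := by
  have h := shiftSum_shiftSum_stair (N := N)
    (isAlternating_alternantPairing (P * vandermondePoly N))
    (alternantPairing_eq_zero_of_neg _) hK hN
  rw [integral_vandermondeLaw_eval_mul_conj, integral_vandermondeLaw_eval_mul_conj, mul_assoc]
  have h2 : alternantPairing (MvPolynomial.psum (Fin N) ℂ K * (P * vandermondePoly N)) =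
      shiftSum (-K) (alternantPairing (P * vandermondePoly N)) :=
    funext (alternantPairing_psum_mul K _)
  simp only [Function.iterate_succ, Function.iterate_zero, Function.comp, id]
  rw [h2, shiftSum_comm K (-K), h]
  ring

theorem integral_psum_mul {N k : ℕ} (hk : 1 ≤ k) (K : ℕ) (P : MvPolynomial (Fin N) ℂ) :
    ∫ y, MvPolynomial.eval y (MvPolynomial.psum (Fin N) ℂ k * P) *
      (starRingEnd ℂ) ((∑ i, y i ^ K) ^ 0) ∂vandermondeLaw N = 0 := by
  rw [integral_vandermondeLaw_eval_mul_conj, mul_assoc, Function.iterate_zero, id,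
    alternantPairing_psum_mul, shiftSum_neg_stair (isAlternating_alternantPairing _)
      (alternantPairing_eq_zero_of_neg _) hk, mul_zero]

theorem integral_vandermondeLaw_one (N : ℕ) : ∫ _, (1 : ℂ) ∂vandermondeLaw N = 1 := by
  have h := integral_vandermondeLaw_eval_mul_conj (N := N) 1 0 0
  simp only [map_one, pow_zero, mul_one, one_mul, Function.iterate_zero, id,
    alternantPairing_vandermondePoly] at h
  rw [h]
  push_cast
  exact inv_mul_cancel₀ (by exact_mod_cast Nat.factorial_ne_zero N)

theorem integral_conj_psum_pow {N K j : ℕ} (hK : 1 ≤ K) (hj : 1 ≤ j) :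
    ∫ y, (starRingEnd ℂ) ((∑ i, y i ^ K) ^ j) ∂vandermondeLaw N = 0 := by
  obtain ⟨j, rfl⟩ := Nat.exists_eq_add_of_le' hj
  have h := integral_psum_mul (N := N) hK K (MvPolynomial.psum (Fin N) ℂ K ^ j)
  rw [integral_conj]
  simp only [pow_zero, map_one, mul_one, map_mul, map_pow] at h
  have h2 : ∀ y : Fin N → ℂ, MvPolynomial.eval y (MvPolynomial.psum (Fin N) ℂ K) = ∑ i, y i ^ K := by
    intro y; simp [MvPolynomial.psum]
  simp_rw [h2, ← pow_succ'] at h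
  rw [h, map_zero]

/-- Each factor p_K on the left removes one conjugated factor. With fewer than two factors a
conjugated power sum of mean zero is left over; with more, a power sum times a polynomial, again of
mean zero. -/
theorem powerMoment_psum_pow {N K : ℕ} (hK : 1 ≤ K) (hN : 2 * K ≤ N) (j : ℕ) :
    powerMoment N K (MvPolynomial.psum (Fin N) ℂ K ^ j) = if j = 2 then 2 * (K : ℂ) ^ 2 else 0 := by
  match j with
  | 0 =>
    have := integral_conj_psum_pow (N := N) hK (j := 2) (by norm_num)
    simpa [powerMoment] using this
  | 1 =>
    have := integral_conj_psum_pow (N := N) hK (j := 1) (by norm_num)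
    rw [pow_one, ← mul_one (MvPolynomial.psum _ _ _), powerMoment_psum_mul hK hN hK, if_pos rfl]
    simp only [map_one, one_mul, this]
    simp
  | 2 =>
    rw [sq (MvPolynomial.psum (Fin N) ℂ K), powerMoment_psum_mul hK hN hK, if_pos rfl,
      ← mul_one (MvPolynomial.psum _ _ _), integral_psum_mul_conj_psum hK (by omega)]
    simp only [map_one, pow_zero, mul_one, integral_vandermondeLaw_one, if_true]
    ring
  | j + 3 =>
    rw [show j + 3 = j + 1 + 1 + 1 from rfl, pow_succ', pow_succ', pow_succ',
      powerMoment_psum_mul hK hN hK, if_pos rfl, integral_psum_mul_conj_psum hK (by omega),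
      integral_psum_mul hK]
    simp

/-! ### The latent law -/

theorem integrable_vandermonde_density (N : ℕ) :
    Integrable (fun y : Fin N → ℂ => ‖vandermondeProd y‖ ^ 2 / (Nat.factorial N : ℝ))
      (torusLaw N) := by
  have h : Integrable (fun y : Fin N → ℂ =>
      ((‖vandermondeProd y‖ ^ 2 / (Nat.factorial N : ℝ) : ℝ) : ℂ)) (torusLaw N) := by
    refine integrable_torusLaw (Continuous.continuousOn ?_)
    have := continuous_vandermondeProd (N := N)
    exact Complex.continuous_ofReal.comp (by fun_prop)
  have h2 := h.re
  simp only [RCLike.re_to_complex, Complex.ofReal_re] at h2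
  exact h2

instance (N : ℕ) : IsFiniteMeasure (vandermondeLaw N) :=
  isFiniteMeasure_withDensity_ofReal (integrable_vandermonde_density N).2

instance (N : ℕ) : IsProbabilityMeasure (vandermondeLaw N) := by
  constructor
  have h := integral_vandermondeLaw_one N
  rw [integral_const, Complex.real_smul, mul_one] at h
  have h' : (vandermondeLaw N).real Set.univ = 1 := by exact_mod_cast h
  rw [Measure.real, ENNReal.toReal_eq_one_iff] at h'
  exact h'

instance (N D : ℕ) : IsProbabilityMeasure (latentLaw N D) := by
  unfold latentLaw; infer_instance

/-- The product of tori that carries the latent law. -/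
def latentTorus (N D : ℕ) : Set ((Fin N → ℂ) × (Fin D → ℂ) × (Fin D → ℂ)) :=
  torus N ×ˢ torus D ×ˢ torus D

theorem isCompact_latentTorus (N D : ℕ) : IsCompact (latentTorus N D) :=
  (isCompact_torus N).prod ((isCompact_torus D).prod (isCompact_torus D))

theorem ae_latentLaw (N D : ℕ) : ∀ᵐ p ∂latentLaw N D, p ∈ latentTorus N D := by
  have h1 : ∀ᵐ y ∂vandermondeLaw N, y ∈ torus N :=
    (withDensity_absolutelyContinuous _ _).ae_le (ae_torusLaw N)
  have h2 : ∀ᵐ x ∂(torusLaw D).prod (torusLaw D), x ∈ torus D ×ˢ torus D := by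
    filter_upwards [Measure.quasiMeasurePreserving_fst.ae (ae_torusLaw D),
      Measure.quasiMeasurePreserving_snd.ae (ae_torusLaw D)] with x hx hx'
    exact ⟨hx, hx'⟩
  unfold latentLaw
  filter_upwards [Measure.quasiMeasurePreserving_fst.ae h1,
    Measure.quasiMeasurePreserving_snd.ae h2] with x hx hx'
  exact ⟨hx, hx'⟩

theorem integrable_latentLaw {N D : ℕ} {f : (Fin N → ℂ) × (Fin D → ℂ) × (Fin D → ℂ) → ℂ}
    (hf : Continuous f) : Integrable f (latentLaw N D) :=
  integrable_of_continuousOn_of_ae_mem (isCompact_latentTorus N D) (ae_latentLaw N D)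
    hf.continuousOn

theorem integrable_torusLaw_prod {D : ℕ} {f : (Fin D → ℂ) × (Fin D → ℂ) → ℂ}
    (hf : Continuous f) : Integrable f ((torusLaw D).prod (torusLaw D)) := by
  have h2 : ∀ᵐ x ∂(torusLaw D).prod (torusLaw D), x ∈ torus D ×ˢ torus D := by
    filter_upwards [Measure.quasiMeasurePreserving_fst.ae (ae_torusLaw D),
      Measure.quasiMeasurePreserving_snd.ae (ae_torusLaw D)] with x hx hx'
    exact ⟨hx, hx'⟩
  exact integrable_of_continuousOn_of_ae_mem ((isCompact_torus D).prod (isCompact_torus D)) h2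
    hf.continuousOn

theorem integral_latentLaw_mul {N D : ℕ} (f : (Fin N → ℂ) → ℂ)
    (g : (Fin D → ℂ) × (Fin D → ℂ) → ℂ) :
    ∫ p, f p.1 * g p.2 ∂latentLaw N D =
      (∫ y, f y ∂vandermondeLaw N) * ∫ x, g x ∂(torusLaw D).prod (torusLaw D) := by
  unfold latentLaw
  have : IsFiniteMeasure ((torusLaw D).prod (torusLaw D)) := inferInstance
  have : SigmaFinite ((torusLaw D).prod (torusLaw D)) := IsFiniteMeasure.toSigmaFinite _
  have hs : SFinite ((torusLaw D).prod (torusLaw D)) := @instSFiniteOfSigmaFinite _ _ _ this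
  exact @integral_prod_mul _ _ _ _ (vandermondeLaw N) ((torusLaw D).prod (torusLaw D))
    hs inferInstance _ _ f g

theorem integral_add_add_two_mul {X : Type*} [MeasurableSpace X] {μ : Measure X} {f g h : X → ℂ}
    (hf : Integrable f μ) (hg : Integrable g μ) (hh : Integrable h μ) :
    ∫ x, f x + (g x + 2 * h x) ∂μ = ∫ x, f x ∂μ + (∫ x, g x ∂μ + 2 * ∫ x, h x ∂μ) := by
  rw [integral_add hf (f := f) (g := fun x => g x + 2 * h x) (hg.add (hh.const_mul 2)),
    integral_add hg (hh.const_mul 2), integral_const_mul]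

theorem integral_add_add_add {X : Type*} [MeasurableSpace X] {μ : Measure X} {f g h k : X → ℂ}
    (hf : Integrable f μ) (hg : Integrable g μ) (hh : Integrable h μ) (hk : Integrable k μ) :
    ∫ x, f x + g x + (h x + k x) ∂μ =
      ∫ x, f x ∂μ + ∫ x, g x ∂μ + (∫ x, h x ∂μ + ∫ x, k x ∂μ) := by
  rw [integral_add (f := fun x => f x + g x) (g := fun x => h x + k x) (hf.add hg) (hh.add hk),
    integral_add hf hg, integral_add hh hk]

/-- The monomial `q^α`. -/
def mono {D : ℕ} (α : Fin D → ℕ) (q : Fin D → ℂ) : ℂ := ∏ d, q d ^ α d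

@[fun_prop]
theorem continuous_mono {D : ℕ} (α : Fin D → ℕ) : Continuous (mono α) := by
  unfold mono; fun_prop

theorem mono_add {D : ℕ} (α β : Fin D → ℕ) (q : Fin D → ℂ) :
    mono (α + β) q = mono α q * mono β q := by
  simp [mono, pow_add, Finset.prod_mul_distrib]

theorem mono_zero {D : ℕ} (q : Fin D → ℂ) : mono 0 q = 1 := by simp [mono]

theorem mono_smul {D : ℕ} (α : Fin D → ℕ) (t : ℂ) (q : Fin D → ℂ) :
    mono α (t • q) = t ^ (∑ d, α d) * mono α q := by
  simp [mono, mul_pow, Finset.prod_mul_distrib, Finset.prod_pow_eq_pow_sum]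

theorem integral_mono_mul_conj_mono {D : ℕ} (α β : Fin D → ℕ) :
    ∫ q, mono α q * (starRingEnd ℂ) (mono β q) ∂torusLaw D = if α = β then 1 else 0 := by
  have h := integral_torusLaw_monomial α fun i => (β i : ℤ)
  simp only [zpow_natCast] at h
  unfold mono
  rw [h]
  simp [funext_iff]

theorem integral_mono_mono {D : ℕ} (a b c d : Fin D → ℕ) :
    ∫ x : (Fin D → ℂ) × (Fin D → ℂ), mono a x.1 * mono b x.2 *
      (starRingEnd ℂ) (mono c x.1 * mono d x.2) ∂(torusLaw D).prod (torusLaw D) =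
      if a = c ∧ b = d then 1 else 0 := by
  have h : ∀ x : (Fin D → ℂ) × (Fin D → ℂ), mono a x.1 * mono b x.2 *
      (starRingEnd ℂ) (mono c x.1 * mono d x.2) =
      (mono a x.1 * (starRingEnd ℂ) (mono c x.1)) *
        (mono b x.2 * (starRingEnd ℂ) (mono d x.2)) := by
    intro x; rw [map_mul]; ring
  simp_rw [h]
  rw [integral_prod_mul (fun q => mono a q * (starRingEnd ℂ) (mono c q))
    (fun r => mono b r * (starRingEnd ℂ) (mono d r)), integral_mono_mul_conj_mono,
    integral_mono_mul_conj_mono]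
  split_ifs <;> simp_all

theorem continuous_mono_mono {D : ℕ} (a b c d : Fin D → ℕ) :
    Continuous fun x : (Fin D → ℂ) × (Fin D → ℂ) => mono a x.1 * mono b x.2 *
      (starRingEnd ℂ) (mono c x.1 * mono d x.2) := by
  have := Complex.continuous_conj
  fun_prop

theorem ne_zero_of_sum_eq {D K : ℕ} (hK : 1 ≤ K) {α : Fin D → ℕ} (h : ∑ d, α d = K) :
    α ≠ 0 := by
  rintro rfl
  simp at h
  omega

/-- The terms q^(a+b) and r^(a+b) involve only one of the two variables, hence are orthogonal to q^α
r^β with α, β nonzero. The cross terms give the two ways of matching a, b with α, β, which is ∂_α∂_β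
(X_a X_b). -/
theorem integral_binomial_binomial_mul_conj {D K : ℕ} (hK : 1 ≤ K) {a b α β : Fin D → ℕ}
    (hα : ∑ d, α d = K) (hβ : ∑ d, β d = K) :
    ∫ x : (Fin D → ℂ) × (Fin D → ℂ), (mono a x.1 + mono a x.2) * (mono b x.1 + mono b x.2) *
      (starRingEnd ℂ) (mono α x.1 * mono β x.2) ∂(torusLaw D).prod (torusLaw D) =
      (if a = α ∧ b = β then 1 else 0) + if b = α ∧ a = β then 1 else 0 := by
  have hα0 := ne_zero_of_sum_eq hK hα
  have hβ0 := ne_zero_of_sum_eq hK hβ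
  have h : ∀ x : (Fin D → ℂ) × (Fin D → ℂ),
      (mono a x.1 + mono a x.2) * (mono b x.1 + mono b x.2) *
      (starRingEnd ℂ) (mono α x.1 * mono β x.2) =
      (mono (a + b) x.1 * mono 0 x.2 * (starRingEnd ℂ) (mono α x.1 * mono β x.2) +
      mono 0 x.1 * mono (a + b) x.2 * (starRingEnd ℂ) (mono α x.1 * mono β x.2)) +
      (mono a x.1 * mono b x.2 * (starRingEnd ℂ) (mono α x.1 * mono β x.2) +
      mono b x.1 * mono a x.2 * (starRingEnd ℂ) (mono α x.1 * mono β x.2)) := by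
    intro x; simp only [mono_add, mono_zero]; ring
  have hi := fun a b => integrable_torusLaw_prod (continuous_mono_mono a b α β)
  simp_rw [h]
  rw [integral_add_add_add (hi _ _) (hi _ _) (hi _ _) (hi _ _)]
  simp_rw [integral_mono_mono]
  simp [hα0.symm, hβ0.symm]

/-- For a = b the expansion u² + v² + 2uv has orthonormal monomials, so its squared norm is 1 + 1 +
4 = 6. -/
theorem integral_binomial_sq_mul_conj_sq {D K : ℕ} (hK : 1 ≤ K) {a b : Fin D → ℕ}
    (ha : ∑ d, a d = K) (hb : ∑ d, b d = K) :
    ∫ x : (Fin D → ℂ) × (Fin D → ℂ), (mono a x.1 + mono a x.2) ^ 2 *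
      (starRingEnd ℂ) ((mono b x.1 + mono b x.2) ^ 2) ∂(torusLaw D).prod (torusLaw D) =
      if a = b then 6 else 0 := by
  have ha0 := ne_zero_of_sum_eq hK ha
  have hb0 := ne_zero_of_sum_eq hK hb
  have h : ∀ x : (Fin D → ℂ) × (Fin D → ℂ), (mono a x.1 + mono a x.2) ^ 2 *
      (starRingEnd ℂ) ((mono b x.1 + mono b x.2) ^ 2) =
      (mono a x.1 + mono a x.2) * (mono a x.1 + mono a x.2) *
        (starRingEnd ℂ) (mono (b + b) x.1 * mono 0 x.2) +
      ((mono a x.1 + mono a x.2) * (mono a x.1 + mono a x.2) *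
        (starRingEnd ℂ) (mono 0 x.1 * mono (b + b) x.2) +
      2 * ((mono a x.1 + mono a x.2) * (mono a x.1 + mono a x.2) *
        (starRingEnd ℂ) (mono b x.1 * mono b x.2))) := by
    intro x; simp only [mono_add, mono_zero, map_mul, map_pow, map_add, map_one]; ring
  have h2 : ∀ (c d : Fin D → ℕ) (x : (Fin D → ℂ) × (Fin D → ℂ)),
      (mono a x.1 + mono a x.2) * (mono a x.1 + mono a x.2) *
        (starRingEnd ℂ) (mono c x.1 * mono d x.2) =
      mono (a + a) x.1 * mono 0 x.2 * (starRingEnd ℂ) (mono c x.1 * mono d x.2) +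
      (mono 0 x.1 * mono (a + a) x.2 * (starRingEnd ℂ) (mono c x.1 * mono d x.2) +
      2 * (mono a x.1 * mono a x.2 * (starRingEnd ℂ) (mono c x.1 * mono d x.2))) := by
    intro c d x; simp only [mono_add, mono_zero]; ring
  have hi := fun a b c d => integrable_torusLaw_prod (continuous_mono_mono (D := D) a b c d)
  have hI : ∀ c d : Fin D → ℕ, ∫ x : (Fin D → ℂ) × (Fin D → ℂ),
      (mono a x.1 + mono a x.2) * (mono a x.1 + mono a x.2) *
        (starRingEnd ℂ) (mono c x.1 * mono d x.2) ∂(torusLaw D).prod (torusLaw D) =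
      (if a + a = c ∧ 0 = d then 1 else 0) + ((if 0 = c ∧ a + a = d then 1 else 0) +
        2 * if a = c ∧ a = d then 1 else 0) := by
    intro c d
    simp_rw [h2]
    rw [integral_add_add_two_mul (hi _ _ _ _) (hi _ _ _ _) (hi _ _ _ _)]
    simp_rw [integral_mono_mono]
  have hi2 : ∀ c d : Fin D → ℕ, Integrable (fun x : (Fin D → ℂ) × (Fin D → ℂ) =>
      (mono a x.1 + mono a x.2) * (mono a x.1 + mono a x.2) *
        (starRingEnd ℂ) (mono c x.1 * mono d x.2)) ((torusLaw D).prod (torusLaw D)) := by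
    intro c d
    refine integrable_torusLaw_prod ?_
    have := Complex.continuous_conj
    fun_prop
  simp_rw [h]
  rw [integral_add_add_two_mul (hi2 _ _) (hi2 _ _) (hi2 _ _)]
  simp_rw [hI]
  have hdbl : ∀ c d : Fin D → ℕ, c + c = d + d ↔ c = d := by
    intro c d
    refine ⟨fun h => funext fun i => ?_, fun h => by rw [h]⟩
    have := congrFun h i
    simp only [Pi.add_apply] at this
    omega
  have haa : a + a ≠ 0 := fun h => ha0 ((hdbl a 0).1 (by simpa using h))
  have hbb : b + b ≠ 0 := fun h => hb0 ((hdbl b 0).1 (by simpa using h))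
  simp only [hdbl, ha0, haa, hbb.symm, hb0.symm, and_true, true_and,
    and_false, false_and, if_false, and_self]
  split_ifs <;> norm_num

/-! ### Pairings of polynomials in multisymmetric power sums -/

/-- The unnormalized multisymmetric power sum of the input `X(y,q,r)`, set to zero for `γ = 0`. -/
def latentPowerSum {N D : ℕ} (p : (Fin N → ℂ) × (Fin D → ℂ) × (Fin D → ℂ)) (γ : Fin D → ℕ) : ℂ :=
  if γ = 0 then 0 else (∑ i, p.1 i ^ (∑ d, γ d)) * (mono γ p.2.1 + mono γ p.2.2)

@[fun_prop]
theorem continuous_latentPowerSum {N D : ℕ} (γ : Fin D → ℕ) :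
    Continuous fun p : (Fin N → ℂ) × (Fin D → ℂ) × (Fin D → ℂ) => latentPowerSum p γ := by
  unfold latentPowerSum
  split_ifs <;> fun_prop

theorem continuous_eval_latentPowerSum {N D : ℕ} (P : MvPolynomial (Fin D → ℕ) ℂ) :
    Continuous fun p : (Fin N → ℂ) × (Fin D → ℂ) × (Fin D → ℂ) =>
      MvPolynomial.eval (latentPowerSum p) P :=
  (MvPolynomial.continuous_eval P).comp (continuous_pi fun γ => continuous_latentPowerSum γ)

/-- The test function `p_K(y)^2 q^α r^β`. -/
def testFunction {N D : ℕ} (K : ℕ) (α β : Fin D → ℕ)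
    (p : (Fin N → ℂ) × (Fin D → ℂ) × (Fin D → ℂ)) : ℂ :=
  (∑ i, p.1 i ^ K) ^ 2 * (mono α p.2.1 * mono β p.2.2)

@[fun_prop]
theorem continuous_testFunction {N D : ℕ} (K : ℕ) (α β : Fin D → ℕ) :
    Continuous (testFunction (N := N) K α β) := by
  unfold testFunction
  fun_prop

theorem integral_mul_conj_testFunction {N D : ℕ} (K : ℕ) (α β : Fin D → ℕ)
    (P : MvPolynomial (Fin N) ℂ) (g : (Fin D → ℂ) × (Fin D → ℂ) → ℂ) :
    ∫ p, MvPolynomial.eval p.1 P * g p.2 * (starRingEnd ℂ) (testFunction K α β p)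
      ∂latentLaw N D = powerMoment N K P *
        ∫ x, g x * (starRingEnd ℂ) (mono α x.1 * mono β x.2) ∂(torusLaw D).prod (torusLaw D) := by
  rw [powerMoment, ← integral_latentLaw_mul]
  congr 1
  funext p
  rw [testFunction, map_mul]
  ring

theorem integral_eval_monomial_mul_conj_testFunction {N D : ℕ} (K : ℕ) (α β : Fin D → ℕ)
    (s : (Fin D → ℕ) →₀ ℕ) (hs : ∀ γ ∈ s.support, γ ≠ 0) :
    ∫ p, MvPolynomial.eval (latentPowerSum p) (MvPolynomial.monomial s 1) *
      (starRingEnd ℂ) (testFunction K α β p) ∂latentLaw N D =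
      powerMoment N K (∏ γ ∈ s.support, MvPolynomial.psum (Fin N) ℂ (∑ d, γ d) ^ s γ) *
        ∫ x, (∏ γ ∈ s.support, (mono γ x.1 + mono γ x.2) ^ s γ) *
          (starRingEnd ℂ) (mono α x.1 * mono β x.2) ∂(torusLaw D).prod (torusLaw D) := by
  rw [← integral_mul_conj_testFunction]
  congr 1
  funext p
  rw [MvPolynomial.eval_monomial, one_mul, Finsupp.prod, map_prod, ← Finset.prod_mul_distrib]
  congr 1
  refine Finset.prod_congr rfl fun γ hγ => ?_
  rw [latentPowerSum, if_neg (hs γ hγ), mul_pow]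
  simp [MvPolynomial.psum]

theorem constantCoeff_pderiv_pderiv_monomial {σ : Type*} (α β : σ)
    (s : σ →₀ ℕ) (hs : s ≠ Finsupp.single α 1 + Finsupp.single β 1) :
    MvPolynomial.constantCoeff (MvPolynomial.pderiv α (MvPolynomial.pderiv β
      (MvPolynomial.monomial s (1 : ℂ)))) = 0 := by
  classical
  rw [MvPolynomial.pderiv_monomial, MvPolynomial.pderiv_monomial, MvPolynomial.constantCoeff_monomial]
  split_ifs with h
  · by_contra hne
    have h1 : s β ≠ 0 := by rintro h0; simp [h0] at hne
    have h2 : (s - Finsupp.single β 1 : σ →₀ ℕ) α ≠ 0 := by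
      rintro h0; rw [h0] at hne; simp at hne
    refine hs ?_
    have h3 : s - Finsupp.single β 1 = Finsupp.single α 1 := by
      refine le_antisymm (tsub_eq_zero_iff_le.1 h) ?_
      rw [Finsupp.single_le_iff]
      omega
    rw [← h3, tsub_add_cancel_of_le]
    rw [Finsupp.single_le_iff]
    omega
  · rfl

theorem exists_eq_single_add_single {σ : Type*} (s : σ →₀ ℕ) (hs : ∑ γ ∈ s.support, s γ = 2) :
    ∃ a b, s = Finsupp.single a 1 + Finsupp.single b 1 := by
  have h0 : s ≠ 0 := by rintro rfl; simp at hs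
  obtain ⟨a, ha⟩ := Finsupp.support_nonempty_iff.2 h0
  have ha' : Finsupp.single a 1 ≤ s := by
    rw [Finsupp.single_le_iff]
    have := Finsupp.mem_support_iff.1 ha
    omega
  have hdeg : (s - Finsupp.single a 1).degree = 1 := by
    have h1 : s.degree = 2 := hs
    have h2 : ((s - Finsupp.single a 1) + Finsupp.single a 1).degree = 2 := by
      rw [tsub_add_cancel_of_le ha', h1]
    rw [map_add, Finsupp.degree_single] at h2
    omega
  set t := s - Finsupp.single a 1 with ht
  have ht0 : t ≠ 0 := by rintro h; simp [h] at hdeg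
  obtain ⟨b, hb⟩ := Finsupp.support_nonempty_iff.2 ht0
  have hb' : Finsupp.single b 1 ≤ t := by
    rw [Finsupp.single_le_iff]
    have := Finsupp.mem_support_iff.1 hb
    omega
  have hb0 : t - Finsupp.single b 1 = 0 := by
    rw [← Finsupp.degree_eq_zero_iff]
    have h2 : ((t - Finsupp.single b 1) + Finsupp.single b 1).degree = 1 := by
      rw [tsub_add_cancel_of_le hb', hdeg]
    rw [map_add, Finsupp.degree_single] at h2
    omega
  refine ⟨b, a, ?_⟩
  rw [← le_antisymm (tsub_eq_zero_iff_le.1 hb0) hb', ht, tsub_add_cancel_of_le ha']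

/-- The y integral kills every monomial except products X_a X_b with |a| = |b| = K, and on these the
q, r integral agrees with the second derivative. -/
theorem integral_monomial_mul_conj_testFunction {N D K : ℕ} (hK : 1 ≤ K) (hN : 2 * K ≤ N)
    {α β : Fin D → ℕ} (hα : ∑ d, α d = K) (hβ : ∑ d, β d = K) (s : (Fin D → ℕ) →₀ ℕ) :
    ∫ p, MvPolynomial.eval (latentPowerSum p) (MvPolynomial.monomial s 1) *
      (starRingEnd ℂ) (testFunction K α β p) ∂latentLaw N D =
      2 * (K : ℂ) ^ 2 * MvPolynomial.constantCoeff (MvPolynomial.pderiv α (MvPolynomial.pderiv β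
        (MvPolynomial.monomial s (1 : ℂ)))) := by
  -- If X_0 occurs, both sides vanish: `latentPowerSum` is zero at the exponent 0, and α, β are
  -- nonzero because K ≥ 1.
  by_cases h0 : 0 ∈ s.support
  · have hz : ∀ p : (Fin N → ℂ) × (Fin D → ℂ) × (Fin D → ℂ),
        MvPolynomial.eval (latentPowerSum p) (MvPolynomial.monomial s (1 : ℂ)) = 0 := by
      intro p
      rw [MvPolynomial.eval_monomial, one_mul, Finsupp.prod]
      refine Finset.prod_eq_zero h0 ?_
      rw [latentPowerSum, if_pos rfl, zero_pow (Finsupp.mem_support_iff.1 h0)]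
    rw [constantCoeff_pderiv_pderiv_monomial]
    · simp [hz]
    · rintro rfl
      rw [Finsupp.mem_support_iff] at h0
      simp [ne_zero_of_sum_eq hK hα, ne_zero_of_sum_eq hK hβ] at h0
  have hs0 : ∀ γ ∈ s.support, γ ≠ 0 := fun γ hγ h => h0 (h ▸ hγ)
  have hpos : ∀ γ ∈ s.support, 1 ≤ ∑ d, γ d := by
    intro γ hγ
    by_contra hlt
    refine hs0 γ hγ (funext fun d => ?_)
    have : ∑ d, γ d = 0 := by omega
    exact Finset.sum_eq_zero_iff.1 this d (Finset.mem_univ d)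
  rw [integral_eval_monomial_mul_conj_testFunction K α β s hs0]
  by_cases hA : ∃ γ ∈ s.support, ∑ d, γ d ≠ K
  · obtain ⟨γ, hγ, hγK⟩ := hA
    rw [constantCoeff_pderiv_pderiv_monomial]
    · rw [← Finset.mul_prod_erase _ _ hγ]
      obtain ⟨n, hn⟩ := Nat.exists_eq_succ_of_ne_zero (Finsupp.mem_support_iff.1 hγ)
      rw [hn, pow_succ', mul_assoc, powerMoment_psum_mul hK hN (hpos γ hγ), if_neg hγK]
      simp
    · rintro rfl
      rw [Finsupp.mem_support_iff] at hγ
      have h1 : α ≠ γ := by rintro rfl; exact hγK hα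
      have h2 : β ≠ γ := by rintro rfl; exact hγK hβ
      simp [h1, h2] at hγ
  push Not at hA
  have hprod : ∏ γ ∈ s.support, MvPolynomial.psum (Fin N) ℂ (∑ d, γ d) ^ s γ =
      MvPolynomial.psum (Fin N) ℂ K ^ (∑ γ ∈ s.support, s γ) := by
    rw [← Finset.prod_pow_eq_pow_sum]
    exact Finset.prod_congr rfl fun γ hγ => by rw [hA γ hγ]
  rw [hprod, powerMoment_psum_pow hK hN]
  split_ifs with hdeg
  · obtain ⟨a, b, rfl⟩ := exists_eq_single_add_single s hdeg
    have h1 : ∀ x : (Fin D → ℂ) × (Fin D → ℂ),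
        ∏ γ ∈ (Finsupp.single a 1 + Finsupp.single b 1 : (Fin D → ℕ) →₀ ℕ).support,
          (mono γ x.1 + mono γ x.2) ^ (Finsupp.single a 1 + Finsupp.single b 1 :
            (Fin D → ℕ) →₀ ℕ) γ = (mono a x.1 + mono a x.2) * (mono b x.1 + mono b x.2) := by
      intro x
      have := Finsupp.prod_add_index' (f := Finsupp.single a 1)
        (g := (Finsupp.single b 1 : (Fin D → ℕ) →₀ ℕ))
        (h := fun γ n => (mono γ x.1 + mono γ x.2) ^ n) (by simp) (fun _ _ _ => pow_add _ _ _)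
      rw [Finsupp.prod] at this
      rw [this]
      simp
    simp_rw [h1]
    rw [integral_binomial_binomial_mul_conj hK hα hβ]
    have h2 : MvPolynomial.monomial (Finsupp.single a 1 + Finsupp.single b 1) (1 : ℂ) =
        MvPolynomial.X a * MvPolynomial.X b := by
      simp [MvPolynomial.X, MvPolynomial.monomial_mul]
    rw [h2]
    congr 1
    simp only [Derivation.leibniz, MvPolynomial.pderiv_X, smul_eq_mul, map_add, map_mul,
      MvPolynomial.constantCoeff_X, Pi.single_apply]
    simp only [zero_mul, zero_add, apply_ite MvPolynomial.constantCoeff, map_one, map_zero,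
      mul_ite, mul_one, mul_zero, ← ite_and]
  · rw [constantCoeff_pderiv_pderiv_monomial]
    · simp
    · rintro rfl
      refine hdeg ?_
      change Finsupp.degree _ = 2
      simp

/-- For `|α| = |β| = K`, the pairing with `p_K(y)^2 q^α r^β` reads off a second order Taylor
coefficient of a polynomial in the multisymmetric power sums. -/
theorem integral_eval_mul_conj_testFunction {N D K : ℕ} (hK : 1 ≤ K) (hN : 2 * K ≤ N)
    {α β : Fin D → ℕ} (hα : ∑ d, α d = K) (hβ : ∑ d, β d = K) (P : MvPolynomial (Fin D → ℕ) ℂ) :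
    ∫ p, MvPolynomial.eval (latentPowerSum p) P *
      (starRingEnd ℂ) (testFunction K α β p) ∂latentLaw N D =
      2 * (K : ℂ) ^ 2 * MvPolynomial.constantCoeff
        (MvPolynomial.pderiv α (MvPolynomial.pderiv β P)) := by
  have hcont : ∀ P : MvPolynomial (Fin D → ℕ) ℂ,
      Integrable (fun p : (Fin N → ℂ) × (Fin D → ℂ) × (Fin D → ℂ) =>
      MvPolynomial.eval (latentPowerSum p) P *
      (starRingEnd ℂ) (testFunction K α β p)) (latentLaw N D) := by
    intro P
    refine integrable_latentLaw ((continuous_eval_latentPowerSum P).mul ?_)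
    exact Complex.continuous_conj.comp (continuous_testFunction K α β)
  induction P using MvPolynomial.induction_on' with
  | monomial s a =>
    have h := integral_monomial_mul_conj_testFunction hK hN hα hβ s
    have h1 : MvPolynomial.monomial s a = MvPolynomial.C a * MvPolynomial.monomial s 1 := by
      simp [MvPolynomial.C_mul_monomial]
    rw [h1]
    simp only [map_mul, MvPolynomial.eval_C, mul_assoc, Derivation.leibniz, smul_eq_mul,
      MvPolynomial.pderiv_C, mul_zero, add_zero, MvPolynomial.constantCoeff_C]
    rw [integral_const_mul, h]
    ring
  | add P Q hP hQ =>
    simp only [map_add, add_mul, mul_add]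
    rw [integral_add (hcont P) (hcont Q), hP, hQ]

/-! ### Low rank approximation and Bessel's inequality -/

/-- A matrix that factors through dimension `L` has squared Frobenius distance at least
`‖a‖² (n - L)` from `a` times the identity of size `n`. -/
theorem le_sum_norm_sq_sub_ite {ι : Type*} [Fintype ι] [DecidableEq ι] {L : ℕ}
    (w : ι → Fin L → ℂ) (c : Fin L → ι → ℂ) (a : ℂ) :
    ‖a‖ ^ 2 * ((Fintype.card ι : ℝ) - L) ≤
      ∑ i, ∑ j, ‖(∑ l, w i l * c l j) - if i = j then a else 0‖ ^ 2 := by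
  -- On the kernel of the right factor, of dimension at least n - L, the difference acts as -a. Its
  -- squared Frobenius norm is at least the sum of its squared norms on an orthonormal basis of that
  -- kernel.
  let φ : EuclideanSpace ℂ ι →ₗ[ℂ] (Fin L → ℂ) :=
    { toFun := fun v l => ∑ j, c l j * v j
      map_add' := by
        intro u v; funext l; simp [mul_add, Finset.sum_add_distrib]
      map_smul' := by
        intro t v; funext l; simp [Finset.mul_sum, mul_left_comm] }
  let U := LinearMap.ker φ
  have hdim : (Fintype.card ι : ℝ) - L ≤ Module.finrank ℂ U := by
    have h1 := LinearMap.finrank_range_add_finrank_ker φ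
    have h2 : Module.finrank ℂ (LinearMap.range φ) ≤ L := by
      simpa using Submodule.finrank_le (LinearMap.range φ)
    rw [finrank_euclideanSpace] at h1
    have : Fintype.card ι ≤ L + Module.finrank ℂ U := by
      simp only [U]; omega
    have h3 : (Fintype.card ι : ℝ) ≤ L + Module.finrank ℂ U := by exact_mod_cast this
    linarith
  let b := stdOrthonormalBasis ℂ U
  let v : Fin (Module.finrank ℂ U) → EuclideanSpace ℂ ι := fun k => (b k : EuclideanSpace ℂ ι)
  have hv : Orthonormal ℂ v := b.orthonormal.comp_linearIsometry U.subtypeₗᵢ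
  have hker : ∀ k l, ∑ j, c l j * v k j = 0 := by
    intro k l
    exact congrFun (LinearMap.mem_ker.1 (b k).2) l
  -- The rows are conjugated so that the Hermitian product with `v k` is, up to conjugation, the
  -- entry of the matrix–vector product.
  let row : ι → EuclideanSpace ℂ ι := fun i => WithLp.toLp 2 fun j =>
    (starRingEnd ℂ) ((∑ l, w i l * c l j) - if i = j then a else 0)
  have hinner : ∀ i k, ‖inner ℂ (v k) (row i)‖ = ‖a‖ * ‖v k i‖ := by
    intro i k
    rw [← inner_conj_symm, RCLike.norm_conj, PiLp.inner_apply]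
    simp only [row, RCLike.inner_apply, starRingEnd_self_apply]
    have : ∑ j, v k j * ((∑ l, w i l * c l j) - if i = j then a else 0) = -(a * v k i) := by
      simp_rw [mul_sub, Finset.sum_sub_distrib, Finset.mul_sum]
      rw [Finset.sum_comm]
      have h0 : ∀ l, ∑ j, v k j * (w i l * c l j) = 0 := by
        intro l
        have : ∑ j, v k j * (w i l * c l j) = w i l * ∑ j, c l j * v k j := by
          rw [Finset.mul_sum]
          exact Finset.sum_congr rfl fun j _ => by ring
        rw [this, hker, mul_zero]
      simp_rw [h0]
      simp [mul_comm]
    rw [this, norm_neg, norm_mul]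
  have hrow : ∀ i, ∑ k, (‖a‖ * ‖v k i‖) ^ 2 ≤
      ∑ j, ‖(∑ l, w i l * c l j) - if i = j then a else 0‖ ^ 2 := by
    intro i
    have := hv.sum_inner_products_le (row i) (s := Finset.univ)
    simp_rw [hinner] at this
    refine this.trans (le_of_eq ?_)
    rw [EuclideanSpace.norm_sq_eq]
    simp only [row, RCLike.norm_conj]
  refine le_trans ?_ (Finset.sum_le_sum fun i _ => hrow i)
  rw [Finset.sum_comm]
  simp_rw [mul_pow, ← Finset.mul_sum]
  have hone : ∀ k, ∑ i, ‖v k i‖ ^ 2 = 1 := by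
    intro k
    rw [← EuclideanSpace.norm_sq_eq, hv.1 k, one_pow]
  simp_rw [hone]
  simp only [Finset.sum_const, Finset.card_univ, Fintype.card_fin, nsmul_eq_mul, mul_one]
  exact mul_le_mul_of_nonneg_left hdim (by positivity)

theorem sum_norm_sq_integral_mul_conj_le {X κ : Type*} [MeasurableSpace X] [Fintype κ]
    [DecidableEq κ] {μ : Measure X} {H : X → ℂ} (hH : MemLp H 2 μ) {e : κ → X → ℂ}
    (he : ∀ k, MemLp (e k) 2 μ)
    (horth : ∀ k l, ∫ x, e k x * (starRingEnd ℂ) (e l x) ∂μ = if k = l then 1 else 0) :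
    ∑ k, ‖∫ x, H x * (starRingEnd ℂ) (e k x) ∂μ‖ ^ 2 ≤ ∫ x, ‖H x‖ ^ 2 ∂μ := by
  have hin : ∀ {f g : X → ℂ} (hf : MemLp f 2 μ) (hg : MemLp g 2 μ),
      inner ℂ (hg.toLp g) (hf.toLp f) = ∫ x, f x * (starRingEnd ℂ) (g x) ∂μ := by
    intro f g hf hg
    rw [L2.inner_def]
    refine integral_congr_ae ?_
    filter_upwards [hf.coeFn_toLp, hg.coeFn_toLp] with x h1 h2
    rw [h1, h2, RCLike.inner_apply]
  have ho : Orthonormal ℂ fun k => (he k).toLp (e k) := by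
    rw [orthonormal_iff_ite]
    intro i j
    rw [hin, horth]
    simp [eq_comm]
  have h := ho.sum_inner_products_le (hH.toLp H) (s := Finset.univ)
  simp_rw [hin] at h
  refine h.trans (le_of_eq ?_)
  have h2 := hin hH hH
  rw [inner_self_eq_norm_sq_to_K] at h2
  have h3 : ∀ x, H x * (starRingEnd ℂ) (H x) = ((‖H x‖ ^ 2 : ℝ) : ℂ) := by
    intro x; rw [Complex.mul_conj, Complex.normSq_eq_norm_sq]
  simp_rw [h3] at h2
  rw [integral_complex_ofReal] at h2
  refine Complex.ofReal_injective ?_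
  rw [Complex.ofReal_pow]
  exact h2

/-! ### Polynomial singleton symmetric networks -/

theorem sum_setInput {N D : ℕ} (p : (Fin N → ℂ) × (Fin D → ℂ) × (Fin D → ℂ))
    (φ : (Fin D → ℂ) → ℂ) :
    ∑ n, φ (fun d => setInput p d n) = ∑ i, (φ (p.1 i • p.2.1) + φ (p.1 i • p.2.2)) := by
  have h2 : 2 * N = N + N := by ring
  rw [← Equiv.sum_comp (finCongr h2.symm), Fin.sum_univ_add, Finset.sum_add_distrib]
  congr 1
  · refine Finset.sum_congr rfl fun i _ => ?_
    congr 1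
    funext d
    simp [setInput, mul_comm]
  · refine Finset.sum_congr rfl fun i _ => ?_
    congr 1
    funext d
    simp [setInput, mul_comm]

/-- The constant monomial sums to the number 2N of columns; `latentPowerSum` drops it, and
`columnSumForm` restores it as a constant. -/
theorem sum_mono_setInput {N D : ℕ} (p : (Fin N → ℂ) × (Fin D → ℂ) × (Fin D → ℂ))
    (γ : Fin D → ℕ) :
    ∑ n, mono γ (fun d => setInput p d n) =
      latentPowerSum p γ + if γ = 0 then (2 * N : ℂ) else 0 := by
  rw [sum_setInput]
  simp_rw [mono_smul, ← mul_add]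
  rw [← Finset.sum_mul, latentPowerSum]
  split_ifs with h
  · subst h
    simp [mono_zero]
    ring
  · simp

theorem multiPowerSum_setInput {N D : ℕ} (p : (Fin N → ℂ) × (Fin D → ℂ) × (Fin D → ℂ))
    {K : ℕ} (hK : 1 ≤ K) {α : Fin D → ℕ} (hα : ∑ d, α d = K) :
    multiPowerSum α (setInput p) = ((1 / Real.sqrt K : ℝ) : ℂ) * latentPowerSum p α := by
  have h0 := ne_zero_of_sum_eq hK hα
  have := sum_mono_setInput p α
  rw [if_neg h0, add_zero] at this
  rw [multiPowerSum, if_neg h0, hα, ← this]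
  rfl

/-- The affine form in the multisymmetric power sums given by summing `ψ` over the columns. -/
def columnSumForm {D : ℕ} (N : ℕ) (ψ : MvPolynomial (Fin D) ℂ) : MvPolynomial (Fin D → ℕ) ℂ :=
  MvPolynomial.C (2 * N * ψ.coeff 0) +
    ∑ d ∈ ψ.support, MvPolynomial.C (ψ.coeff d) * MvPolynomial.X (d : Fin D → ℕ)

theorem eval_columnSumForm {N D : ℕ} (ψ : MvPolynomial (Fin D) ℂ)
    (p : (Fin N → ℂ) × (Fin D → ℂ) × (Fin D → ℂ)) :
    MvPolynomial.eval (latentPowerSum p) (columnSumForm N ψ) =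
      ∑ n, MvPolynomial.eval (fun d => setInput p d n) ψ := by
  simp_rw [MvPolynomial.eval_eq']
  rw [Finset.sum_comm]
  simp_rw [← Finset.mul_sum]
  have h : ∀ d : Fin D →₀ ℕ, ∑ n, ∏ i, setInput p i n ^ d i =
      latentPowerSum p d + if d = 0 then (2 * N : ℂ) else 0 := by
    intro d
    have hd : d = 0 ↔ (d : Fin D → ℕ) = 0 := by
      rw [← DFunLike.coe_injective.eq_iff (b := (0 : Fin D →₀ ℕ)), Finsupp.coe_zero]
    rw [if_congr hd rfl rfl]
    exact sum_mono_setInput p d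
  simp_rw [h, mul_add, Finset.sum_add_distrib]
  rw [columnSumForm, map_add, MvPolynomial.eval_C, map_sum, add_comm]
  congr 1
  · simp
  · simp only [mul_ite, mul_zero, Finset.sum_ite_eq', MvPolynomial.mem_support_iff, ne_eq]
    split_ifs with h0
    · rw [h0, mul_zero]
    · ring

theorem exists_pderiv_columnSumForm_eq_C {D : ℕ} (N : ℕ) (ψ : MvPolynomial (Fin D) ℂ)
    (α : Fin D → ℕ) :
    ∃ c, MvPolynomial.pderiv α (columnSumForm N ψ) = MvPolynomial.C c := by
  refine ⟨∑ d ∈ ψ.support, ψ.coeff d * if (d : Fin D → ℕ) = α then 1 else 0, ?_⟩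
  rw [columnSumForm, map_add, map_sum, MvPolynomial.pderiv_C, zero_add, map_sum]
  refine Finset.sum_congr rfl fun d _ => ?_
  rw [Derivation.leibniz, MvPolynomial.pderiv_C, smul_zero, add_zero, MvPolynomial.pderiv_X,
    smul_eq_mul, map_mul, Pi.single_apply]
  split_ifs <;> simp

theorem pderiv_aeval {σ τ : Type*} [Fintype σ] (ℓ : σ → MvPolynomial τ ℂ) (t : τ)
    (ρ : MvPolynomial σ ℂ) :
    MvPolynomial.pderiv t (MvPolynomial.aeval ℓ ρ) =
      ∑ s, MvPolynomial.aeval ℓ (MvPolynomial.pderiv s ρ) * MvPolynomial.pderiv t (ℓ s) := by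
  classical
  induction ρ using MvPolynomial.induction_on with
  | C a => simp [MvPolynomial.algebraMap_eq]
  | add p q hp hq => simp only [map_add, hp, hq, add_mul, Finset.sum_add_distrib]
  | mul_X p i hp =>
    have h : ∀ s, MvPolynomial.aeval ℓ (MvPolynomial.pderiv s (p * MvPolynomial.X i)) *
        MvPolynomial.pderiv t (ℓ s) =
        (if i = s then MvPolynomial.aeval ℓ p * MvPolynomial.pderiv t (ℓ s) else 0) +
        ℓ i * (MvPolynomial.aeval ℓ (MvPolynomial.pderiv s p) * MvPolynomial.pderiv t (ℓ s)) := by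
      intro s
      rw [Derivation.leibniz, MvPolynomial.pderiv_X, Pi.single_apply, map_add, smul_eq_mul,
        smul_eq_mul, map_mul, map_mul, MvPolynomial.aeval_X, add_mul, mul_assoc (ℓ i)]
      split_ifs <;> simp
    rw [Finset.sum_congr rfl fun s _ => h s, Finset.sum_add_distrib, ← Finset.mul_sum, ← hp,
      Finset.sum_ite_eq, if_pos (Finset.mem_univ i), map_mul, MvPolynomial.aeval_X,
      Derivation.leibniz, smul_eq_mul, smul_eq_mul]

/-- The singleton symmetric network with polynomial encoders `ψ` and polynomial decoder `ρ`. -/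
def polyNet {D M L : ℕ} (ψ : Fin L → MvPolynomial (Fin D) ℂ) (ρ : MvPolynomial (Fin L) ℂ)
    (X : Matrix (Fin D) (Fin M) ℂ) : ℂ :=
  MvPolynomial.eval (fun l => ∑ n, MvPolynomial.eval (fun d => X d n) (ψ l)) ρ

theorem polyNet_setInput {N D L : ℕ} (ψ : Fin L → MvPolynomial (Fin D) ℂ)
    (ρ : MvPolynomial (Fin L) ℂ) (p : (Fin N → ℂ) × (Fin D → ℂ) × (Fin D → ℂ)) :
    polyNet ψ ρ (setInput p) = MvPolynomial.eval (latentPowerSum p)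
      (MvPolynomial.aeval (fun l => columnSumForm N (ψ l)) ρ) := by
  rw [polyNet]
  simp_rw [← eval_columnSumForm]
  rw [MvPolynomial.aeval_def, MvPolynomial.algebraMap_eq]
  induction ρ using MvPolynomial.induction_on with
  | C a => simp
  | add p q hp hq => simp only [map_add, MvPolynomial.eval₂_add, hp, hq]
  | mul_X p i hp => simp only [map_mul, MvPolynomial.eval₂_mul, MvPolynomial.eval₂_X, hp,
      MvPolynomial.eval_X]

/-- The inner forms are affine, so ∂_β of the composite is ∑ (∂_l ρ)(ℓ) c_{lβ} with constants c.
Differentiating once more leaves c alone, so the Hessian factors through dimension L. -/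
theorem exists_constantCoeff_pderiv_pderiv_eq_sum {N D L : ℕ}
    (ψ : Fin L → MvPolynomial (Fin D) ℂ) (ρ : MvPolynomial (Fin L) ℂ) :
    ∃ (w : (Fin D → ℕ) → Fin L → ℂ) (c : Fin L → (Fin D → ℕ) → ℂ), ∀ α β,
      MvPolynomial.constantCoeff (MvPolynomial.pderiv α (MvPolynomial.pderiv β
        (MvPolynomial.aeval (fun l => columnSumForm N (ψ l)) ρ))) = ∑ l, w α l * c l β := by
  choose c hc using fun l α => exists_pderiv_columnSumForm_eq_C N (ψ l) α
  refine ⟨fun α l => MvPolynomial.constantCoeff (MvPolynomial.pderiv α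
    (MvPolynomial.aeval (fun l => columnSumForm N (ψ l)) (MvPolynomial.pderiv l ρ))), c,
    fun α β => ?_⟩
  rw [pderiv_aeval, map_sum, map_sum]
  refine Finset.sum_congr rfl fun l _ => ?_
  rw [hc, Derivation.leibniz, MvPolynomial.pderiv_C, smul_zero, zero_add, smul_eq_mul, map_mul,
    MvPolynomial.constantCoeff_C, mul_comm]

/-! ### The hard function -/

/-- The exponents of degree `K`. -/
abbrev Exponents (D K : ℕ) : Finset (Fin D → ℕ) :=
  Finset.piAntidiag (Finset.univ : Finset (Fin D)) K

theorem sum_eq_of_mem {D K : ℕ} {α : Fin D → ℕ} (h : α ∈ Exponents D K) : ∑ d, α d = K := by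
  simpa [Exponents, Finset.mem_piAntidiag] using h

/-- The normalizing constant of the hard function. -/
def hardConst (N D : ℕ) : ℝ := 1 / Real.sqrt (12 * ((Exponents D (N / 2)).card : ℝ))

theorem hardFunction_setInput {N D : ℕ} (hN : 2 ≤ N)
    (p : (Fin N → ℂ) × (Fin D → ℂ) × (Fin D → ℂ)) :
    hardFunction N D (setInput p) = ((hardConst N D / (N / 2 : ℕ) : ℝ) : ℂ) *
      ∑ α ∈ Exponents D (N / 2), latentPowerSum p α ^ 2 := by
  have hK : 1 ≤ N / 2 := by omega
  have h : ∀ α ∈ Exponents D (N / 2), multiPowerSum α (setInput p) ^ 2 =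
      ((1 / (N / 2 : ℕ) : ℝ) : ℂ) * latentPowerSum p α ^ 2 := by
    intro α hα
    rw [multiPowerSum_setInput p hK (sum_eq_of_mem hα), mul_pow]
    congr 1
    rw [← Complex.ofReal_pow, div_pow, one_pow, Real.sq_sqrt (by positivity)]
  have hc : hardConst N D / (N / 2 : ℕ) =
      1 / Real.sqrt (12 * ((Exponents D (N / 2)).card : ℝ)) * (1 / (N / 2 : ℕ)) := by
    rw [hardConst]; ring
  rw [hardFunction, Finset.sum_congr rfl h, ← Finset.mul_sum, ← mul_assoc, hc, Complex.ofReal_mul]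

/-- The hard function as a polynomial in the multisymmetric power sums. -/
def hardPoly (N D : ℕ) : MvPolynomial (Fin D → ℕ) ℂ :=
  MvPolynomial.C ((hardConst N D / (N / 2 : ℕ) : ℝ) : ℂ) *
    ∑ α ∈ Exponents D (N / 2), MvPolynomial.X α ^ 2

theorem eval_hardPoly {N D : ℕ} (hN : 2 ≤ N)
    (p : (Fin N → ℂ) × (Fin D → ℂ) × (Fin D → ℂ)) :
    MvPolynomial.eval (latentPowerSum p) (hardPoly N D) = hardFunction N D (setInput p) := by
  rw [hardFunction_setInput hN]
  simp [hardPoly]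

theorem continuous_hardFunction_setInput {N D : ℕ} (hN : 2 ≤ N) :
    Continuous fun p : (Fin N → ℂ) × (Fin D → ℂ) × (Fin D → ℂ) =>
      hardFunction N D (setInput p) := by
  simp_rw [← eval_hardPoly hN]
  exact continuous_eval_latentPowerSum _

theorem constantCoeff_pderiv_pderiv_hardPoly {N D : ℕ} {α β : Fin D → ℕ}
    (hα : α ∈ Exponents D (N / 2)) :
    MvPolynomial.constantCoeff (MvPolynomial.pderiv α (MvPolynomial.pderiv β (hardPoly N D))) =
      if α = β then ((2 * (hardConst N D / (N / 2 : ℕ)) : ℝ) : ℂ) else 0 := by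
  rw [hardPoly, MvPolynomial.pderiv_C_mul, MvPolynomial.pderiv_C_mul, map_mul,
    MvPolynomial.constantCoeff_C, map_sum, map_sum, map_sum]
  have h : ∀ γ ∈ Exponents D (N / 2), MvPolynomial.constantCoeff (MvPolynomial.pderiv α
      (MvPolynomial.pderiv β (MvPolynomial.X γ ^ 2 : MvPolynomial (Fin D → ℕ) ℂ))) =
      if α = γ then (if α = β then 2 else 0) else 0 := by
    intro γ _
    rw [sq]
    simp only [Derivation.leibniz, MvPolynomial.pderiv_X, smul_eq_mul, map_add, map_mul,
      MvPolynomial.constantCoeff_X, Pi.single_apply, zero_mul, zero_add,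
      apply_ite MvPolynomial.constantCoeff, map_one, map_zero]
    by_cases h1 : α = γ
    · subst h1
      by_cases h2 : α = β
      · subst h2
        norm_num
      · simp [h2]
    · have h1' : ¬ γ = α := fun h => h1 h.symm
      simp [h1, h1']
  rw [Finset.sum_congr rfl h, Finset.sum_ite_eq, if_pos hα]
  split_ifs
  · push_cast; ring
  · simp

theorem integral_testFunction_mul_conj {N D K : ℕ} (hK : 1 ≤ K) (hN : 2 * K ≤ N)
    (α β α' β' : Fin D → ℕ) :
    ∫ p, testFunction K α β p * (starRingEnd ℂ) (testFunction K α' β' p) ∂latentLaw N D =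
      if α = α' ∧ β = β' then 2 * (K : ℂ) ^ 2 else 0 := by
  have h := integral_mul_conj_testFunction (N := N) K α' β' (MvPolynomial.psum (Fin N) ℂ K ^ 2)
    (fun x => mono α x.1 * mono β x.2)
  rw [powerMoment_psum_pow hK hN, if_pos rfl, integral_mono_mono] at h
  simp only [map_pow, MvPolynomial.psum, map_sum, MvPolynomial.eval_X] at h
  rw [mul_ite, mul_one, mul_zero] at h
  exact h

/-! ### The error of polynomial networks -/

theorem normA_sq {N D : ℕ} (f : Matrix (Fin D) (Fin (2 * N)) ℂ → ℂ) :
    normA f ^ 2 = ∫ p, ‖f (setInput p)‖ ^ 2 ∂latentLaw N D := by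
  have h : ∀ p : (Fin N → ℂ) × (Fin D → ℂ) × (Fin D → ℂ),
      f (setInput p) * (starRingEnd ℂ) (f (setInput p)) = ((‖f (setInput p)‖ ^ 2 : ℝ) : ℂ) := by
    intro p; rw [Complex.mul_conj, Complex.normSq_eq_norm_sq]
  unfold normA innerA
  simp_rw [h]
  rw [integral_complex_ofReal, Complex.ofReal_re, Real.sq_sqrt]
  exact integral_nonneg fun p => by positivity

theorem memLp_latentLaw {N D : ℕ} {f : (Fin N → ℂ) × (Fin D → ℂ) × (Fin D → ℂ) → ℂ}
    (hf : Continuous f) : MemLp f 2 (latentLaw N D) := by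
  rw [memLp_two_iff_integrable_sq_norm (integrable_latentLaw hf).1]
  have h : Integrable (fun p => ((‖f p‖ ^ 2 : ℝ) : ℂ)) (latentLaw N D) :=
    integrable_latentLaw (Complex.continuous_ofReal.comp (by fun_prop))
  have h2 := h.re
  simp only [RCLike.re_to_complex, Complex.ofReal_re] at h2
  exact h2

/-- The constant 12K² is 2K² from y times 6 from q and r; it explains the 12 in the normalization of
the hard function. -/
theorem integral_latentPowerSum_sq_mul_conj {N D K : ℕ} (hK : 1 ≤ K) (hN : 2 * K ≤ N)
    {α β : Fin D → ℕ} (hα : ∑ d, α d = K) (hβ : ∑ d, β d = K) :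
    ∫ p, latentPowerSum p α ^ 2 * (starRingEnd ℂ) (latentPowerSum p β ^ 2) ∂latentLaw N D =
      if α = β then 12 * (K : ℂ) ^ 2 else 0 := by
  have h : ∀ p : (Fin N → ℂ) × (Fin D → ℂ) × (Fin D → ℂ),
      latentPowerSum p α ^ 2 * (starRingEnd ℂ) (latentPowerSum p β ^ 2) =
      (MvPolynomial.eval p.1 (MvPolynomial.psum (Fin N) ℂ K ^ 2) *
        (starRingEnd ℂ) ((∑ i, p.1 i ^ K) ^ 2)) *
      ((mono α p.2.1 + mono α p.2.2) ^ 2 *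
        (starRingEnd ℂ) ((mono β p.2.1 + mono β p.2.2) ^ 2)) := by
    intro p
    rw [latentPowerSum, latentPowerSum, if_neg (ne_zero_of_sum_eq hK hα),
      if_neg (ne_zero_of_sum_eq hK hβ), hα, hβ]
    simp only [map_pow, MvPolynomial.psum, map_sum, MvPolynomial.eval_X, map_mul]
    ring
  simp_rw [h]
  have h2 := integral_latentLaw_mul (N := N) (D := D)
    (fun y => MvPolynomial.eval y (MvPolynomial.psum (Fin N) ℂ K ^ 2) *
        (starRingEnd ℂ) ((∑ i, y i ^ K) ^ 2))
    (fun x => (mono α x.1 + mono α x.2) ^ 2 *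
        (starRingEnd ℂ) ((mono β x.1 + mono β x.2) ^ 2))
  rw [h2, integral_binomial_sq_mul_conj_sq hK hα hβ]
  have h3 := powerMoment_psum_pow (N := N) hK hN 2
  rw [powerMoment, if_pos rfl] at h3
  rw [h3]
  split_ifs <;> ring

theorem hardConst_sq {N D : ℕ} :
    hardConst N D ^ 2 = 1 / (12 * ((Exponents D (N / 2)).card : ℝ)) := by
  rw [hardConst, div_pow, one_pow, Real.sq_sqrt (by positivity)]

theorem normA_hardFunction {N D : ℕ} (hN : 2 ≤ N) (hT : 0 < (Exponents D (N / 2)).card) :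
    normA (hardFunction N D) = 1 := by
  have hK : 1 ≤ N / 2 := by omega
  have hnonneg : 0 ≤ normA (hardFunction N D) := Real.sqrt_nonneg _
  have hint : innerA (hardFunction N D) (hardFunction N D) = 1 := by
    unfold innerA
    set κ : ℂ := ((hardConst N D / (N / 2 : ℕ) : ℝ) : ℂ) with hκ
    have h : ∀ p : (Fin N → ℂ) × (Fin D → ℂ) × (Fin D → ℂ),
        hardFunction N D (setInput p) * (starRingEnd ℂ) (hardFunction N D (setInput p)) =
        ∑ α ∈ Exponents D (N / 2), ∑ β ∈ Exponents D (N / 2),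
          κ ^ 2 * (latentPowerSum p α ^ 2 * (starRingEnd ℂ) (latentPowerSum p β ^ 2)) := by
      intro p
      rw [hardFunction_setInput hN, map_mul, Complex.conj_ofReal, map_sum, mul_mul_mul_comm,
        Finset.sum_mul_sum, ← sq, Finset.mul_sum]
      exact Finset.sum_congr rfl fun α _ => Finset.mul_sum _ _ _
    have hi : ∀ α β : Fin D → ℕ, Integrable (fun p : (Fin N → ℂ) × (Fin D → ℂ) × (Fin D → ℂ) =>
        κ ^ 2 * (latentPowerSum p α ^ 2 * (starRingEnd ℂ) (latentPowerSum p β ^ 2)))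
        (latentLaw N D) := by
      intro α β
      have := Complex.continuous_conj
      exact integrable_latentLaw (by fun_prop)
    simp_rw [h]
    rw [integral_finsetSum _ fun α _ => integrable_finsetSum _ fun β _ => hi α β]
    have h2 : ∀ α ∈ Exponents D (N / 2), ∫ p : (Fin N → ℂ) × (Fin D → ℂ) × (Fin D → ℂ),
        ∑ β ∈ Exponents D (N / 2), κ ^ 2 * (latentPowerSum p α ^ 2 *
          (starRingEnd ℂ) (latentPowerSum p β ^ 2)) ∂latentLaw N D =
        κ ^ 2 * (12 * ((N / 2 : ℕ) : ℂ) ^ 2) := by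
      intro α hα
      rw [integral_finsetSum _ fun β _ => hi α β]
      have h3 : ∀ β ∈ Exponents D (N / 2), ∫ p : (Fin N → ℂ) × (Fin D → ℂ) × (Fin D → ℂ),
          κ ^ 2 * (latentPowerSum p α ^ 2 *
          (starRingEnd ℂ) (latentPowerSum p β ^ 2)) ∂latentLaw N D =
          if α = β then κ ^ 2 * (12 * ((N / 2 : ℕ) : ℂ) ^ 2) else 0 := by
        intro β hβ
        rw [integral_const_mul, integral_latentPowerSum_sq_mul_conj hK (by omega)
          (sum_eq_of_mem hα) (sum_eq_of_mem hβ), mul_ite, mul_zero]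
      rw [Finset.sum_congr rfl h3, Finset.sum_ite_eq, if_pos hα]
    rw [Finset.sum_congr rfl h2, Finset.sum_const, nsmul_eq_mul, hκ]
    have hT' : ((Exponents D (N / 2)).card : ℝ) ≠ 0 := by positivity
    have hK' : ((N / 2 : ℕ) : ℝ) ≠ 0 := by positivity
    have : ((Exponents D (N / 2)).card : ℝ) * ((hardConst N D / (N / 2 : ℕ)) ^ 2 *
        (12 * ((N / 2 : ℕ) : ℝ) ^ 2)) = 1 := by
      rw [div_pow, hardConst_sq]
      field_simp
    exact_mod_cast congrArg (fun x : ℝ => (x : ℂ)) this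
  rw [normA, hint]
  simp

/-- The error bound for polynomials in the multisymmetric power sums whose second order Taylor
coefficients form a matrix of low rank. -/
theorem le_integral_norm_sq_eval_sub_hardFunction {N D L : ℕ} (hN : 2 ≤ N)
    (hT : 0 < (Exponents D (N / 2)).card) (P : MvPolynomial (Fin D → ℕ) ℂ)
    (w : (Fin D → ℕ) → Fin L → ℂ) (c : Fin L → (Fin D → ℕ) → ℂ)
    (hP : ∀ α β, MvPolynomial.constantCoeff (MvPolynomial.pderiv α (MvPolynomial.pderiv β P)) =
      ∑ l, w α l * c l β) :
    2 / 3 * (1 - (L : ℝ) / (Exponents D (N / 2)).card) ≤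
      ∫ p, ‖MvPolynomial.eval (latentPowerSum p) P - hardFunction N D (setInput p)‖ ^ 2
        ∂latentLaw N D := by
  have hK : 1 ≤ N / 2 := by omega
  have hKN : 2 * (N / 2) ≤ N := by omega
  set K := N / 2 with hKdef
  set T := (Exponents D K).card with hTdef
  have hT' : (T : ℝ) ≠ 0 := by positivity
  have hK' : (K : ℝ) ≠ 0 := by positivity
  let ι := {α // α ∈ Exponents D K}
  -- The test functions have squared norm 2K², so this factor makes them orthonormal.
  let s : ℝ := 1 / (Real.sqrt 2 * K)
  have hs : s ^ 2 = 1 / (2 * K ^ 2) := by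
    simp only [s]
    rw [div_pow, mul_pow, Real.sq_sqrt (by norm_num), one_pow]
  let e : ι × ι → (Fin N → ℂ) × (Fin D → ℂ) × (Fin D → ℂ) → ℂ :=
    fun k p => (s : ℂ) * testFunction K k.1.1 k.2.1 p
  have he : ∀ k, MemLp (e k) 2 (latentLaw N D) := fun k =>
    memLp_latentLaw (continuous_const.mul (continuous_testFunction K _ _))
  have horth : ∀ k l, ∫ p, e k p * (starRingEnd ℂ) (e l p) ∂latentLaw N D =
      if k = l then 1 else 0 := by
    intro k l
    have h : ∀ p, e k p * (starRingEnd ℂ) (e l p) = ((s ^ 2 : ℝ) : ℂ) *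
        (testFunction K k.1.1 k.2.1 p * (starRingEnd ℂ) (testFunction K l.1.1 l.2.1 p)) := by
      intro p
      simp only [e]
      rw [map_mul, Complex.conj_ofReal]
      push_cast
      ring
    simp_rw [h]
    rw [integral_const_mul, integral_testFunction_mul_conj hK hKN, hs]
    have hkl : (k.1.1 = l.1.1 ∧ k.2.1 = l.2.1) ↔ k = l := by
      rw [Prod.ext_iff, Subtype.ext_iff, Subtype.ext_iff]
    rw [if_congr hkl rfl rfl, mul_ite, mul_zero]
    congr 1
    have : (K : ℂ) ≠ 0 := by exact_mod_cast hK'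
    push_cast
    field_simp
  let P' := P - hardPoly N D
  have hH : ∀ p : (Fin N → ℂ) × (Fin D → ℂ) × (Fin D → ℂ),
      MvPolynomial.eval (latentPowerSum p) P - hardFunction N D (setInput p) =
      MvPolynomial.eval (latentPowerSum p) P' := by
    intro p
    rw [← eval_hardPoly hN, map_sub]
  simp_rw [hH]
  have hbessel := sum_norm_sq_integral_mul_conj_le
    (memLp_latentLaw (continuous_eval_latentPowerSum (N := N) P')) he horth
  refine le_trans ?_ hbessel
  -- The diagonal entry of the Hessian of `hardPoly`.
  set a : ℝ := 2 * (hardConst N D / K) with ha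
  have hcoef : ∀ k : ι × ι, ‖∫ p, MvPolynomial.eval (latentPowerSum p) P' *
      (starRingEnd ℂ) (e k p) ∂latentLaw N D‖ ^ 2 = 2 * K ^ 2 *
      ‖(∑ l, w k.1.1 l * c l k.2.1) - if k.1 = k.2 then (a : ℂ) else 0‖ ^ 2 := by
    intro k
    have h : ∀ p, MvPolynomial.eval (latentPowerSum p) P' * (starRingEnd ℂ) (e k p) =
        (s : ℂ) * (MvPolynomial.eval (latentPowerSum p) P' *
          (starRingEnd ℂ) (testFunction K k.1.1 k.2.1 p)) := by
      intro p
      simp only [e]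
      rw [map_mul, Complex.conj_ofReal]
      ring
    simp_rw [h]
    rw [integral_const_mul, integral_eval_mul_conj_testFunction hK hKN
      (sum_eq_of_mem k.1.2) (sum_eq_of_mem k.2.2)]
    simp only [P', map_sub]
    rw [hP, constantCoeff_pderiv_pderiv_hardPoly k.1.2, norm_mul, norm_mul, mul_pow, mul_pow,
      Complex.norm_real, Real.norm_eq_abs, sq_abs, hs, if_congr Subtype.ext_iff.symm rfl rfl,
      ← mul_assoc]
    congr 1
    have : ‖(2 * (K : ℂ) ^ 2)‖ = 2 * (K : ℝ) ^ 2 := by simp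
    rw [this]
    field_simp
  simp_rw [hcoef]
  rw [← Finset.mul_sum, Fintype.sum_prod_type]
  have hlow := le_sum_norm_sq_sub_ite (fun i : ι => w i.1) (fun l (j : ι) => c l j.1) (a : ℂ)
  have hcard : (Fintype.card ι : ℝ) = T := by simp [ι, hTdef]
  rw [hcard, Complex.norm_real, Real.norm_eq_abs, sq_abs] at hlow
  refine le_trans (le_of_eq ?_) (mul_le_mul_of_nonneg_left hlow (by positivity))
  -- Here a² = 4 / (12 T K²), so 2K² a² (T - L) = (2/3)(1 - L/T).
  rw [ha, mul_pow, div_pow, hardConst_sq, ← hKdef, ← hTdef]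
  field_simp
  ring

theorem le_integral_norm_sq_polyNet_sub_hardFunction {N D L : ℕ} (hN : 2 ≤ N)
    (hT : 0 < (Exponents D (N / 2)).card)
    (ψ : Fin L → MvPolynomial (Fin D) ℂ) (ρ : MvPolynomial (Fin L) ℂ) :
    2 / 3 * (1 - (L : ℝ) / (Exponents D (N / 2)).card) ≤
      ∫ p, ‖polyNet ψ ρ (setInput p) - hardFunction N D (setInput p)‖ ^ 2 ∂latentLaw N D := by
  obtain ⟨w, c, h⟩ := exists_constantCoeff_pderiv_pderiv_eq_sum (N := N) ψ ρ
  simp_rw [polyNet_setInput]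
  exact le_integral_norm_sq_eval_sub_hardFunction hN hT _ w c h

/-! ### Uniform approximation of networks by polynomials -/

/-- The Taylor series of σ at 0 converges absolutely at ‖f‖, so substituting f gives a
norm-convergent series with partial sums in S. Closure of S under conjugation, as in
Stone–Weierstrass, is not needed. -/
theorem comp_entire_mem_of_isClosed {X : Type*} [TopologicalSpace X] [CompactSpace X]
    {S : Subalgebra ℂ C(X, ℂ)} (hS : IsClosed (S : Set C(X, ℂ))) {f : C(X, ℂ)} (hf : f ∈ S)
    {σ : C(ℂ, ℂ)} (hσ : Differentiable ℂ σ) : σ.comp f ∈ S := by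
  let a : ℕ → ℂ := fun n => ((n.factorial : ℂ))⁻¹ * iteratedDeriv n σ 0
  have ha : ∀ z, HasSum (fun n => a n * z ^ n) (σ z) := by
    intro z
    have := Complex.hasSum_taylorSeries_of_entire hσ 0 z
    simp only [sub_zero, smul_eq_mul] at this
    refine this.congr_fun ?_
    intro n
    simp only [a]
    ring
  have hsum : Summable fun n => a n • f ^ n := by
    refine Summable.of_norm_bounded (g := fun n => ‖a n * ((‖f‖ : ℝ) : ℂ) ^ n‖)
      (ha ((‖f‖ : ℝ) : ℂ)).summable.norm fun n => ?_
    have hpow : ‖f ^ n‖ ≤ ‖f‖ ^ n := by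
      refine (ContinuousMap.norm_le _ (by positivity)).2 fun x => ?_
      rw [ContinuousMap.pow_apply, norm_pow]
      exact pow_le_pow_left₀ (norm_nonneg _) (f.norm_coe_le_norm x) n
    rw [norm_smul, norm_mul (a n), norm_pow ((‖f‖ : ℝ) : ℂ), Complex.norm_real, norm_norm]
    exact mul_le_mul_of_nonneg_left hpow (norm_nonneg _)
  have heq : σ.comp f = ∑' n, a n • f ^ n := by
    ext x
    rw [← ContinuousMap.tsum_apply hsum]
    exact (ha (f x)).tsum_eq.symm
  rw [heq]
  refine hS.mem_of_tendsto hsum.hasSum (Filter.Eventually.of_forall fun s => ?_)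
  exact S.sum_mem fun n _ => S.smul_mem (S.pow_mem hf n) _

theorem IsNetwork.continuous {m n : ℕ} {F : (Fin m → ℂ) → Fin n → ℂ} (hF : IsNetwork m n F) :
    Continuous F := by
  induction hF with
  | affine W b => exact (Continuous.matrix_mulVec continuous_const continuous_id).add continuous_const
  | layer F hF σ hσ W b ih =>
    refine (Continuous.matrix_mulVec continuous_const (continuous_pi fun i => ?_)).add
      continuous_const
    have h1 : Continuous (σ i) := continuousOn_univ.1 (hσ i).continuousOn
    exact h1.comp ((continuous_apply i).comp ih)

/-- A coordinate function on a closed ball. -/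
def ballCoordinate {m : ℕ} (R : ℝ) (i : Fin m) : C(Metric.closedBall (0 : Fin m → ℂ) R, ℂ) :=
  ⟨fun x => x.1 i, (continuous_apply i).comp continuous_subtype_val⟩

/-- The polynomial functions on a closed ball. -/
def polynomialFunctions (m : ℕ) (R : ℝ) :
    Subalgebra ℂ C(Metric.closedBall (0 : Fin m → ℂ) R, ℂ) :=
  (MvPolynomial.aeval (ballCoordinate R)).range

theorem aeval_ballCoordinate_apply {m : ℕ} {R : ℝ} (P : MvPolynomial (Fin m) ℂ)
    (x : Metric.closedBall (0 : Fin m → ℂ) R) :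
    (MvPolynomial.aeval (ballCoordinate R) P) x = MvPolynomial.eval x.1 P := by
  induction P using MvPolynomial.induction_on with
  | C a => simp
  | add p q hp hq => simp only [map_add, ContinuousMap.add_apply, hp, hq]
  | mul_X p i hp =>
    simp only [map_mul, ContinuousMap.mul_apply, hp, MvPolynomial.aeval_X, MvPolynomial.eval_X]
    rfl

/-- Induction on layers: the closed algebra generated by the coordinates is stable under linear
combinations, constants and entire activations. -/
theorem IsNetwork.mem_topologicalClosure {m n : ℕ} {F : (Fin m → ℂ) → Fin n → ℂ}
    (hF : IsNetwork m n F) (R : ℝ) : ∀ (j : Fin n)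
    (f : C(Metric.closedBall (0 : Fin m → ℂ) R, ℂ)), (∀ x, f x = F x.1 j) →
    f ∈ (polynomialFunctions m R).topologicalClosure := by
  induction hF with
  | affine W b =>
    intro j f hf
    refine Subalgebra.le_topologicalClosure _ ?_
    refine ⟨MvPolynomial.C (b j) + ∑ i, MvPolynomial.C (W j i) * MvPolynomial.X i, ?_⟩
    ext x
    refine (aeval_ballCoordinate_apply _ x).trans ?_
    rw [hf]
    simp [Matrix.mulVec, dotProduct, add_comm]
  | @layer k n F hF σ hσ W b ih =>
    intro j f hf
    have h1 : ∀ i, Continuous (σ i) := fun i => continuousOn_univ.1 (hσ i).continuousOn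
    have hd : ∀ i, Differentiable ℂ (σ i) := fun i =>
      differentiableOn_univ.1 (hσ i).differentiableOn
    let u : Fin k → C(Metric.closedBall (0 : Fin m → ℂ) R, ℂ) := fun i =>
      ⟨fun x => F x.1 i, (continuous_apply i).comp (hF.continuous.comp continuous_subtype_val)⟩
    have hu : ∀ i, u i ∈ (polynomialFunctions m R).topologicalClosure := fun i =>
      ih i (u i) fun _ => rfl
    have hcomp : ∀ i, (⟨σ i, h1 i⟩ : C(ℂ, ℂ)).comp (u i) ∈
        (polynomialFunctions m R).topologicalClosure := fun i =>
      comp_entire_mem_of_isClosed (Subalgebra.isClosed_topologicalClosure _) (hu i) (hd i)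
    have hfeq : f = ∑ i, W j i • (⟨σ i, h1 i⟩ : C(ℂ, ℂ)).comp (u i) +
        algebraMap ℂ _ (b j) := by
      ext x
      rw [hf]
      simp [Matrix.mulVec, dotProduct, u]
    rw [hfeq]
    exact add_mem (sum_mem fun i _ => Subalgebra.smul_mem _ (hcomp i) _)
      (Subalgebra.algebraMap_mem _ _)

theorem IsScalarNetwork.continuous {m : ℕ} {φ : (Fin m → ℂ) → ℂ} (hφ : IsScalarNetwork m φ) :
    Continuous φ := by
  obtain ⟨F, hF, h⟩ := hφ
  have : φ = fun x => F x 0 := funext h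
  rw [this]
  exact (continuous_apply 0).comp hF.continuous

theorem IsScalarNetwork.exists_norm_sub_eval_le {m : ℕ} {φ : (Fin m → ℂ) → ℂ}
    (hφ : IsScalarNetwork m φ) (R : ℝ) {ε : ℝ} (hε : 0 < ε) :
    ∃ P : MvPolynomial (Fin m) ℂ, ∀ x, ‖x‖ ≤ R → ‖φ x - MvPolynomial.eval x P‖ ≤ ε := by
  have hc := hφ.continuous
  obtain ⟨F, hF, h⟩ := hφ
  let f : C(Metric.closedBall (0 : Fin m → ℂ) R, ℂ) :=
    ⟨fun x => φ x.1, hc.comp continuous_subtype_val⟩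
  have hmem := hF.mem_topologicalClosure R 0 f fun x => h x.1
  rw [← SetLike.mem_coe, Subalgebra.topologicalClosure_coe, Metric.mem_closure_iff] at hmem
  obtain ⟨g, ⟨P, hP⟩, hg⟩ := hmem ε hε
  have hgP : ∀ y, g y = MvPolynomial.eval y.1 P := fun y => by
    rw [← hP]
    exact aeval_ballCoordinate_apply P y
  refine ⟨P, fun x hx => ?_⟩
  have h2 := ((ContinuousMap.dist_lt_iff hε).1 hg) ⟨x, by simpa using hx⟩
  rw [dist_eq_norm, hgP] at h2
  exact h2.le

theorem norm_setInput_column_le {N D : ℕ} {p : (Fin N → ℂ) × (Fin D → ℂ) × (Fin D → ℂ)}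
    (hp : p ∈ latentTorus N D) (n : Fin (2 * N)) : ‖fun d => setInput p d n‖ ≤ 1 := by
  rw [pi_norm_le_iff_of_nonneg zero_le_one]
  intro d
  obtain ⟨h1, h2, h3⟩ := hp
  rw [setInput]
  split_ifs
  · rw [norm_mul, h2 d, h1 _, one_mul]
  · rw [norm_mul, h3 d, h1 _, one_mul]

theorem continuous_setInput_column {N D : ℕ} (n : Fin (2 * N)) :
    Continuous fun (p : (Fin N → ℂ) × (Fin D → ℂ) × (Fin D → ℂ)) (d : Fin D) => setInput p d n := by
  refine continuous_pi fun d => ?_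
  unfold setInput
  split_ifs <;> fun_prop

theorem continuous_of_mem_Sym {N D L : ℕ} {f : Matrix (Fin D) (Fin (2 * N)) ℂ → ℂ}
    (hf : f ∈ Sym D (2 * N) L) :
    Continuous fun p : (Fin N → ℂ) × (Fin D → ℂ) × (Fin D → ℂ) => f (setInput p) := by
  obtain ⟨ψ, ρ, hψ, hρ, h⟩ := hf
  simp_rw [h]
  refine hρ.continuous.comp (continuous_pi fun l => continuous_finsetSum _ fun n _ => ?_)
  exact (hψ l).continuous.comp (continuous_setInput_column n)

/-- The decoder is replaced first, on a ball containing all encoder sums; the uniform continuity of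
the resulting polynomial then fixes the accuracy needed for the encoders. -/
theorem exists_polyNet_norm_sub_le {N D L : ℕ} {f : Matrix (Fin D) (Fin (2 * N)) ℂ → ℂ}
    (hf : f ∈ Sym D (2 * N) L) {ε : ℝ} (hε : 0 < ε) :
    ∃ (ψ : Fin L → MvPolynomial (Fin D) ℂ) (ρ : MvPolynomial (Fin L) ℂ),
      ∀ p ∈ latentTorus N D, ‖f (setInput p) - polyNet ψ ρ (setInput p)‖ ≤ ε := by
  obtain ⟨ψ, ρ, hψ, hρ, h⟩ := hf
  let u : (Fin N → ℂ) × (Fin D → ℂ) × (Fin D → ℂ) → Fin L → ℂ :=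
    fun p l => ∑ n, ψ l fun d => setInput p d n
  have hu : Continuous u := by
    refine continuous_pi fun l => continuous_finsetSum _ fun n _ => ?_
    exact (hψ l).continuous.comp (continuous_setInput_column n)
  obtain ⟨R, hR⟩ := (isCompact_latentTorus N D).exists_bound_of_continuousOn hu.continuousOn
  obtain ⟨ρ', hρ'⟩ := hρ.exists_norm_sub_eval_le R (half_pos hε)
  have huc : UniformContinuousOn (fun v : Fin L → ℂ => MvPolynomial.eval v ρ')
      (Metric.closedBall 0 (R + 1)) :=
    (isCompact_closedBall _ _).uniformContinuousOn_of_continuous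
      (MvPolynomial.continuous_eval ρ').continuousOn
  obtain ⟨δ, hδ, hδ'⟩ := Metric.uniformContinuousOn_iff.1 huc (ε / 2) (half_pos hε)
  set η : ℝ := min (δ / 2) 1 with hη
  have hη0 : 0 < η := by positivity
  -- The errors of the 2N columns add up to at most η; the extra 1 keeps the denominator positive.
  have hη1 : 0 < η / (2 * N + 1) := by positivity
  choose ψ' hψ' using fun l => (hψ l).exists_norm_sub_eval_le 1 hη1
  refine ⟨ψ', ρ', fun p hp => ?_⟩
  let v : Fin L → ℂ := fun l => ∑ n, MvPolynomial.eval (fun d => setInput p d n) (ψ' l)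
  have huv : ‖u p - v‖ ≤ η := by
    rw [pi_norm_le_iff_of_nonneg hη0.le]
    intro l
    have h1 : (u p - v) l = ∑ n, (ψ l (fun d => setInput p d n) -
        MvPolynomial.eval (fun d => setInput p d n) (ψ' l)) := by
      simp [u, v, Finset.sum_sub_distrib]
    rw [h1]
    refine (norm_sum_le _ _).trans ((Finset.sum_le_sum fun n _ =>
      hψ' l _ (norm_setInput_column_le hp n)).trans ?_)
    rw [Finset.sum_const, Finset.card_univ, Fintype.card_fin, nsmul_eq_mul, mul_div_assoc',
      div_le_iff₀ (by positivity)]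
    push_cast
    nlinarith
  have hup := hR p hp
  have hv : ‖v‖ ≤ R + 1 := by
    have : v = u p - (u p - v) := by abel
    rw [this]
    refine (norm_sub_le _ _).trans (add_le_add hup (huv.trans (min_le_right _ _)))
  have h2 := hδ' (u p) (by simpa using hup.trans (by linarith)) v (by simpa using hv)
    (by rw [dist_eq_norm]; exact (huv.trans (min_le_left _ _)).trans_lt (half_lt_self hδ))
  rw [dist_eq_norm] at h2
  rw [h]
  have h3 := hρ' (u p) hup
  have h4 : ρ (u p) - polyNet ψ' ρ' (setInput p) =
      (ρ (u p) - MvPolynomial.eval (u p) ρ') +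
        (MvPolynomial.eval (u p) ρ' - MvPolynomial.eval v ρ') := by
    simp only [polyNet, v]
    ring
  change ‖ρ (u p) - polyNet ψ' ρ' (setInput p)‖ ≤ ε
  rw [h4]
  refine (norm_add_le _ _).trans ?_
  linarith

/-! ### The lower bound -/

theorem le_integral_norm_sq_Sym_sub_hardFunction {N D L : ℕ} (hN : 2 ≤ N)
    (hT : 0 < (Exponents D (N / 2)).card) {f : Matrix (Fin D) (Fin (2 * N)) ℂ → ℂ}
    (hf : f ∈ Sym D (2 * N) L) :
    2 / 3 * (1 - (L : ℝ) / (Exponents D (N / 2)).card) ≤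
      ∫ p, ‖f (setInput p) - hardFunction N D (setInput p)‖ ^ 2 ∂latentLaw N D := by
  have hcont : Continuous fun p : (Fin N → ℂ) × (Fin D → ℂ) × (Fin D → ℂ) =>
      f (setInput p) - hardFunction N D (setInput p) :=
    (continuous_of_mem_Sym hf).sub (continuous_hardFunction_setInput hN)
  obtain ⟨C, hC⟩ := (isCompact_latentTorus N D).exists_bound_of_continuousOn hcont.continuousOn
  have hint : Integrable (fun p : (Fin N → ℂ) × (Fin D → ℂ) × (Fin D → ℂ) =>
      ‖f (setInput p) - hardFunction N D (setInput p)‖ ^ 2) (latentLaw N D) :=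
    (memLp_two_iff_integrable_sq_norm (integrable_latentLaw hcont).1).1 (memLp_latentLaw hcont)
  refine le_of_forall_pos_le_add fun η hη => ?_
  -- With t ≤ |C| and ε ≤ 1, (t + ε)² ≤ t² + ε (2|C| + 1) ≤ t² + η.
  set ε : ℝ := min 1 (η / (2 * |C| + 1)) with hε
  have hε0 : 0 < ε := by positivity
  obtain ⟨ψ, ρ, h⟩ := exists_polyNet_norm_sub_le hf hε0
  refine (le_integral_norm_sq_polyNet_sub_hardFunction hN hT ψ ρ).trans ?_
  have hle : ∀ᵐ p ∂latentLaw N D,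
      ‖polyNet ψ ρ (setInput p) - hardFunction N D (setInput p)‖ ^ 2 ≤
      ‖f (setInput p) - hardFunction N D (setInput p)‖ ^ 2 + η := by
    filter_upwards [ae_latentLaw N D] with p hp
    have h1 := h p hp
    have h2 := (hC p hp).trans (le_abs_self C)
    have h3 : ‖polyNet ψ ρ (setInput p) - hardFunction N D (setInput p)‖ ≤
        ‖f (setInput p) - hardFunction N D (setInput p)‖ + ε := by
      have : polyNet ψ ρ (setInput p) - hardFunction N D (setInput p) =
          (f (setInput p) - hardFunction N D (setInput p)) -
          (f (setInput p) - polyNet ψ ρ (setInput p)) := by ring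
      rw [this]
      exact (norm_sub_le _ _).trans (add_le_add le_rfl h1)
    have h4 : ε * (2 * |C| + 1) ≤ η := by
      rw [← le_div_iff₀ (by positivity)]
      exact min_le_right _ _
    have h5 : ε ≤ 1 := min_le_left _ _
    have h6 := pow_le_pow_left₀ (norm_nonneg _) h3 2
    have h7 := mul_le_mul_of_nonneg_left h2 hε0.le
    nlinarith
  refine (integral_mono_of_nonneg (Filter.Eventually.of_forall fun p => by positivity)
    (hint.add (integrable_const η)) hle).trans (le_of_eq ?_)
  simp only [Pi.add_apply]
  rw [integral_add hint (integrable_const η)]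
  simp

/-! ### Binomial lower bounds for the number of exponents -/

/-- The ratio of the two binomials is (a + b + 1)/(a + 1), which is at least 2 once b ≥ a + 1. -/
theorem two_mul_choose_le {a b : ℕ} (h : a + 1 ≤ b) :
    2 * (a + b).choose a ≤ (a + 1 + b).choose (a + 1) := by
  have h2 := Nat.add_one_mul_choose_eq (a + b) a
  rw [show a + 1 + b = a + b + 1 by ring]
  have h4 : 2 * (a + 1) * (a + b).choose a ≤ (a + b + 1).choose (a + 1) * (a + 1) := by
    rw [← h2]
    exact Nat.mul_le_mul_right _ (by omega)
  refine Nat.le_of_mul_le_mul_right (c := a + 1) ?_ (by omega)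
  linarith

theorem two_pow_le_choose {a b : ℕ} (h : a ≤ b) : 2 ^ a ≤ (a + b).choose a := by
  induction a generalizing b with
  | zero => simp
  | succ a ih =>
    have h1 := ih (b := b) (by omega)
    have h2 := two_mul_choose_le (a := a) (b := b) (by omega)
    rw [pow_succ]
    omega

/-- The extra factor 2 compensates for rounding N/2 down. It needs a ≥ 2, since C(3, 1) < 4; the
induction starts from C(5, 2) = 10 ≥ 8. -/
theorem two_pow_succ_le_choose {a b : ℕ} (ha : 2 ≤ a) (h : a + 1 ≤ b) :
    2 ^ (a + 1) ≤ (a + b).choose a := by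
  induction a, ha using Nat.le_induction generalizing b with
  | base =>
    have h1 : (5 : ℕ).choose 2 ≤ (2 + b).choose 2 := Nat.choose_le_choose 2 (by omega)
    have h2 : (5 : ℕ).choose 2 = 10 := by decide
    omega
  | succ a ha ih =>
    have h1 := ih (b := b) (by omega)
    have h2 := two_mul_choose_le (a := a) (b := b) (by omega)
    rw [pow_succ]
    omega

theorem card_exponents (D K : ℕ) : (Exponents D K).card = (D + K - 1).choose K := by
  rw [Exponents, ← Finset.map_sym_eq_piAntidiag, Finset.card_map]
  have h : (Finset.univ : Finset (Fin D)).sym K = Finset.univ := by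
    ext s; simp
  rw [h, Finset.card_univ, Sym.card_sym_eq_choose, Fintype.card_fin]

/-- With d = D - 1 the count is C(K + d, K). If d ≤ K it is at least 2^d; otherwise it is at least
2^(K+1), and K + 1 ≥ N/2 also for odd N. -/
theorem two_rpow_le_card_exponents {N D : ℕ} (hN : 4 ≤ N) (hD : 3 ≤ D) :
    (2 : ℝ) ^ min ((N : ℝ) / 2) ((D : ℝ) - 1) ≤ (Exponents D (N / 2)).card := by
  obtain ⟨d, rfl⟩ : ∃ d, D = d + 1 := ⟨D - 1, by omega⟩
  rw [card_exponents, show d + 1 + N / 2 - 1 = N / 2 + d by omega]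
  rcases le_or_gt d (N / 2) with h | h
  · have h1 := two_pow_le_choose h
    rw [Nat.choose_symm_add, add_comm d] at h1
    have h2 : min ((N : ℝ) / 2) (((d + 1 : ℕ) : ℝ) - 1) ≤ (d : ℕ) := by
      refine (min_le_right _ _).trans ?_
      push_cast
      linarith
    refine (Real.rpow_le_rpow_of_exponent_le one_le_two h2).trans ?_
    rw [Real.rpow_natCast]
    exact_mod_cast h1
  · have h1 := two_pow_succ_le_choose (a := N / 2) (b := d) (by omega) h
    have h2 : min ((N : ℝ) / 2) (((d + 1 : ℕ) : ℝ) - 1) ≤ (N / 2 + 1 : ℕ) := by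
      refine (min_le_left _ _).trans ?_
      have : N ≤ 2 * (N / 2 + 1) := by omega
      have h3 : (N : ℝ) ≤ 2 * ((N / 2 + 1 : ℕ) : ℝ) := by exact_mod_cast this
      linarith
    refine (Real.rpow_le_rpow_of_exponent_le one_le_two h2).trans ?_
    rw [Real.rpow_natCast]
    exact_mod_cast h1

/-! ### The hard function on the unit sphere, and the worst-case error -/

theorem isSymmetric_hardFunction (N D : ℕ) : IsSymmetric (hardFunction N D) := by
  intro π X
  have h : ∀ α : Fin D → ℕ, multiPowerSum α (X.submatrix id π) = multiPowerSum α X := by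
    intro α
    unfold multiPowerSum
    split_ifs
    · rfl
    · congr 1
      exact Equiv.sum_comp π fun n => ∏ d, X d n ^ α d
  unfold hardFunction
  simp_rw [h]

theorem hardFunction_mem_unitSphereA {N D : ℕ} (hN : 2 ≤ N)
    (hT : 0 < (Exponents D (N / 2)).card) : hardFunction N D ∈ unitSphereA N D :=
  ⟨isSymmetric_hardFunction N D, memLp_latentLaw (continuous_hardFunction_setInput hN),
    normA_hardFunction hN hT⟩

theorem zero_mem_Sym (D M L : ℕ) : (0 : Matrix (Fin D) (Fin M) ℂ → ℂ) ∈ Sym D M L := by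
  have h : ∀ m, IsScalarNetwork m fun _ => 0 := fun m =>
    ⟨_, IsNetwork.affine 0 0, fun x => by simp⟩
  exact ⟨fun _ _ => 0, fun _ => 0, fun _ => h D, h L, fun X => rfl⟩

theorem le_worstCaseError {N D L : ℕ} {g : Matrix (Fin D) (Fin (2 * N)) ℂ → ℂ}
    (hg : g ∈ unitSphereA N D) {b : ℝ} (hb : ∀ f ∈ Sym D (2 * N) L, b ≤ normA (f - g) ^ 2) :
    b ≤ worstCaseError N D L := by
  have : Nonempty (Sym D (2 * N) L) := ⟨⟨0, zero_mem_Sym _ _ _⟩⟩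
  -- A real supremum is meaningful only when bounded above; the bound 1 comes from the zero network,
  -- whose error is ‖g‖² = 1.
  refine le_trans (le_ciInf fun f : Sym D (2 * N) L => hb f.1 f.2)
    (le_ciSup (f := fun g : unitSphereA N D => ⨅ f : Sym D (2 * N) L, normA (f.1 - g.1) ^ 2)
      ⟨1, ?_⟩ ⟨g, hg⟩)
  rintro _ ⟨g', rfl⟩
  refine (ciInf_le ⟨0, ?_⟩ (⟨0, zero_mem_Sym _ _ _⟩ : Sym D (2 * N) L)).trans (le_of_eq ?_)
  · rintro _ ⟨f, rfl⟩
    exact sq_nonneg _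
  · have h := normA_sq g'.1
    rw [g'.2.2.2, one_pow] at h
    rw [normA_sq, h]
    simp

end DeepSets

end

theorem mainTheorem4 (N D L : ℕ) (hm : 2 ≤ min ((N : ℝ) / 2) ((D : ℝ) - 1)) :
    -- the lower bound on the worst-case error
    1 / 6 - (L : ℝ) / (6 * (2 : ℝ) ^ min ((N : ℝ) / 2) ((D : ℝ) - 1)) ≤
        DeepSets.worstCaseError N D L ∧
    -- it is witnessed by the explicit function
    DeepSets.hardFunction N D ∈ DeepSets.unitSphereA N D ∧
    (∀ f ∈ DeepSets.Sym D (2 * N) L,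
      1 / 6 - (L : ℝ) / (6 * (2 : ℝ) ^ min ((N : ℝ) / 2) ((D : ℝ) - 1)) ≤
        DeepSets.normA (f - DeepSets.hardFunction N D) ^ 2) ∧
    -- constant error for exponentially large width
    ((L : ℝ) ≤ (2 : ℝ) ^ (min ((N : ℝ) / 2) ((D : ℝ) - 1) - 3) →
      7 / 48 ≤ DeepSets.worstCaseError N D L) := by
  have hN : 4 ≤ N := by
    have h1 : (4 : ℝ) ≤ N := by linarith [hm.trans (min_le_left _ _)]
    exact_mod_cast h1
  have hD : 3 ≤ D := by
    have h1 : (3 : ℝ) ≤ D := by linarith [hm.trans (min_le_right _ _)]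
    exact_mod_cast h1
  have hcard := DeepSets.two_rpow_le_card_exponents hN hD
  set m := min ((N : ℝ) / 2) ((D : ℝ) - 1) with hmdef
  have hpow : 0 < (2 : ℝ) ^ m := by positivity
  have hTpos : (0 : ℝ) < (DeepSets.Exponents D (N / 2)).card := hpow.trans_le hcard
  have hT : 0 < (DeepSets.Exponents D (N / 2)).card := by exact_mod_cast hTpos
  have hmem := DeepSets.hardFunction_mem_unitSphereA (by omega : 2 ≤ N) hT
  have hbound : ∀ f ∈ DeepSets.Sym D (2 * N) L, 1 / 6 - (L : ℝ) / (6 * (2 : ℝ) ^ m) ≤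
      DeepSets.normA (f - DeepSets.hardFunction N D) ^ 2 := by
    intro f hf
    have h1 := DeepSets.le_integral_norm_sq_Sym_sub_hardFunction (by omega : 2 ≤ N) hT hf
    have h2 := DeepSets.normA_sq (f - DeepSets.hardFunction N D)
    simp only [Pi.sub_apply] at h2
    rw [← h2] at h1
    have h3 : (L : ℝ) / (DeepSets.Exponents D (N / 2)).card ≤ (L : ℝ) / (2 : ℝ) ^ m :=
      div_le_div_of_nonneg_left (Nat.cast_nonneg L) hpow hcard
    have h4 : (L : ℝ) / (6 * (2 : ℝ) ^ m) = 1 / 6 * ((L : ℝ) / (2 : ℝ) ^ m) := by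
      field_simp
    rw [h4]
    have h5 := sq_nonneg (DeepSets.normA (f - DeepSets.hardFunction N D))
    -- If L ≤ 2^m, then 1/6 is weaker than 2/3; otherwise the claimed bound is negative.
    rcases le_or_gt ((L : ℝ) / (2 : ℝ) ^ m) 1 with h6 | h6 <;> linarith
  have hwce := DeepSets.le_worstCaseError hmem hbound
  refine ⟨hwce, hmem, hbound, fun hL => le_trans ?_ hwce⟩
  -- Now L ≤ 2^m / 8, so the loss is at most 1/48 and 1/6 - 1/48 = 7/48.
  rw [Real.rpow_sub two_pos] at hL
  have h7 : (L : ℝ) / (6 * (2 : ℝ) ^ m) ≤ 1 / 48 := by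
    rw [div_le_iff₀ (by positivity)]
    norm_num at hL
    linarith
  linarith
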